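/- Let $J=(J_t)_{t\ge 0}$ be a finite-mean subordinator with respect to a filtration $(\mathcal F_t)_{t\ge0}$ on a probability space $(\Omega,\mathcal F,P)$ (adapted, nondecreasing, right-continuous, $J_0=0$, with stationary increments independent of the past), with exponent $\eta$, i.e. $Ee^{-\alpha J_t}=e^{-\eta(\alpha)t}$ for $\alpha,t\ge0$, and mean $\rho=EJ_1$. Let $\tau$ be a stopping time with $E\tau<\infty$ such that $V:=J_\tau>0$ a.s., and let $R$ be an $\mathcal F_\tau$-measurable random variable (the output rate chosen at time $\tau$) with $R>\rho$ a.s. and $E\frac{V}{R-\rho}<\infty$. During $[0,\tau)$ (the off period) the workload is $J_t$; from $\tau$ on (the on period) it is $J_{\tau+s}-Rs$, $s\ge 0$, until the first time $s=T$ at which it hits $0$, when the cycle ends. Consider the regenerative storage system whose successive cycles are independent copies of this one, and let $Y$ be its workload process restricted to the on periods, i.e. the on-period workload paths of the successive cycles put one after the other. Then $Y$ has a unique steady-state distribution, that is, a unique probability law $\pi$ such that for every bounded continuous $f$ one has $\frac1t\int_0^t f(Y_s)\,ds\to\int f\,d\pi$ a.s. as $t\to\infty$; it is carried by $[0,\infty)$,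 and its Laplace–Stieltjes transform $\tilde Y(\alpha)=\int e^{-\alpha x}\,\pi(dx)$ is $$\tilde Y(\alpha)=\frac{E\left[\frac{1-e^{-\alpha V}}{\alpha R-\eta(\alpha)}\right]}{E\left[\frac{V}{R-\rho}\right]},\qquad \alpha\ge0,$$ where at $\alpha=0$ the ratio $\frac{1-e^{-\alpha V}}{\alpha R-\eta(\alpha)}$ is read as its limit $\frac{V}{R-\rho}$. Moreover, let $U,N,e_1,e_2,\dots$ be random variables, defined together with $(V,R)$ (or with a pair having the same joint law) on a probability space, such that $U$ is uniform on $[0,1]$; the $e_i$ are i.i.d. and nonnegative with $Ee^{-\alpha e_i}=\frac{\eta(\alpha)}{\rho\alpha}$ for $\alpha>0$; $N\ge0$ is integer valued and, conditionally on $(V,R)$, $N+1$ is geometric on $\{1,2,\dots\}$ with success probability $1-\rho/R$, i.e. $P(N=n\mid V,R)=(1-\frac{\rho}{R})(\frac{\rho}{R})^n$ for $n\ge 0$; and $U,e_1,e_2,\dots,(V,R,N)$ are mutually independent. Then $$\tilde Y(\alpha)=E_{V,R}\exp\left\{-\alpha\left(UV+\sum_{i=1}^Ne_i\right)\right\},\qquad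 \alpha\ge0,$$ where $E_{V,R}$ is the expectation under the size-biased measure $P_{V,R}(A)=E\left[\frac{V}{R-\rho}1_A\right]/E\left[\frac{V}{R-\rho}\right]$. -/

import Mathlib

/-
Wald's exponential `exp (-α J_t + η(α) t)` is a martingale. Let `W` be the on-period workload, which
starts at `V = J_τ` and has net exponent `φ = α R - η(α)`, known at time `τ`. Sampling Wald's
martingale at `τ` and at the time `σ` at which `W` first goes below `0`, then integrating in time,
gives the Kella–Whitt identity `E[φ ∫ exp (-α W); B] = E[1 - exp (-α V); B]`, the integral being
over `[τ, σ)`, for every event `B` known at time `τ`. Hence the expectation of `∫ exp (-α W)` is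
`E[(1 - exp (-α V)) / φ]`, and as `α → 0` the mean length of `[τ, σ)` is `E[V / (R - ρ)]`.

The on period ends when `W` first hits `0`, and this is a.s. the same time as `σ`: for `ε > 0` the
passage time at rate `R + ε` is at most the hitting time at rate `R`, and its mean
`E[V / (R + ε - ρ)]` tends to the mean of the passage time at rate `R` as `ε → 0`.

The strong law of large numbers over the i.i.d. cycles identifies the steady-state law with the
normalized expected occupation measure of an on period. The decomposition of its transform rests
on the geometric series
`V / (R - ρ) * (1 - exp (-α V)) / (α V) * ∑ₙ (1 - ρ / R) (ρ / R) ^ n (η(α) / (ρ α)) ^ n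
  = (1 - exp (-α V)) / (α R - η(α))`.
-/

open MeasureTheory ProbabilityTheory Filter Topology
open scoped NNReal ENNReal BoundedContinuousFunction

namespace LevyStorage

noncomputable section

/-- `J` is a subordinator with respect to the filtration `F`: an adapted nondecreasing
right-continuous process that starts at the origin, whose increments are stationary and
independent of the past. -/
structure IsSubordinator {Ω : Type*} [mΩ : MeasurableSpace Ω] (P : Measure Ω)
    (F : Filtration ℝ≥0 mΩ) (J : ℝ≥0 → Ω → ℝ) : Prop where
  adapted : ∀ t, Measurable[F t] (J t)
  zero : ∀ ω, J 0 ω = 0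
  mono : ∀ ω, Monotone fun t => J t ω
  rightCont : ∀ ω t, ContinuousWithinAt (fun s => J s ω) (Set.Ioi t) t
  stationary : ∀ s h, IdentDistrib (fun ω => J (s + h) ω - J s ω) (J h) P P
  indep : ∀ s h,
    Indep (MeasurableSpace.comap (fun ω => J (s + h) ω - J s ω) inferInstance) (F s) P

section Exponent

variable {Ω : Type*} [MeasurableSpace Ω]

/-- The exponent `η` of `J`, that is `E exp (-α J₁) = exp (-η α)`. -/
def exponent (P : Measure Ω) (J : ℝ≥0 → Ω → ℝ) (α : ℝ) : ℝ :=
  -Real.log (∫ ω, Real.exp (-α * J 1 ω) ∂P)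

/-- The mean input rate `ρ = E J₁`. -/
def meanRate (P : Measure Ω) (J : ℝ≥0 → Ω → ℝ) : ℝ := ∫ ω, J 1 ω ∂P

/-- The Laplace–Stieltjes transform at `α` of a law on `[0, ∞)`. -/
def lst (π : Measure ℝ) (α : ℝ) : ℝ := ∫ x, Real.exp (-α * x) ∂π

end Exponent

section Cycle

variable {Ω : Type*}

/-- The workload of the cycle `ω`, `s` time units after the beginning of its on period:
`J (τ + s) - R s`. -/
def onWorkload (J : ℝ≥0 → Ω → ℝ) (τ : Ω → WithTop ℝ≥0) (R : Ω → ℝ) (ω : Ω) (s : ℝ≥0) : ℝ :=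
  J ((τ ω).untopA + s) ω - R ω * s

/-- The length of the on period of the cycle `ω`: the first time at which the workload hits the
origin (`∞` if it never does). -/
def onLength (J : ℝ≥0 → Ω → ℝ) (τ : Ω → WithTop ℝ≥0) (R : Ω → ℝ) (ω : Ω) : ℝ≥0∞ :=
  ⨅ (s : ℝ≥0) (_ : onWorkload J τ R ω s = 0), (s : ℝ≥0∞)

/-- The total length of the first `n` on periods, when the `k`-th cycle is `ω k`. -/
def onEpoch (J : ℝ≥0 → Ω → ℝ) (τ : Ω → WithTop ℝ≥0) (R : Ω → ℝ) (ω : ℕ → Ω) (n : ℕ) : ℝ≥0∞ :=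
  ∑ k ∈ Finset.range n, onLength J τ R (ω k)

/-- The index of the on period in progress at time `t` of the clock that runs only during on
periods: the first `n` with `t < onEpoch (n + 1)`, so that `onEpoch n ≤ t < onEpoch (n + 1)`. -/
def onIndex (J : ℝ≥0 → Ω → ℝ) (τ : Ω → WithTop ℝ≥0) (R : Ω → ℝ) (ω : ℕ → Ω) (t : ℝ≥0) : ℕ :=
  sInf {n : ℕ | (t : ℝ≥0∞) < onEpoch J τ R ω (n + 1)}

/-- The workload process restricted to on periods (the off periods are cut out and the on periods
of the successive cycles `ω 0, ω 1, …` are put one after the other). -/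
def onProcess (J : ℝ≥0 → Ω → ℝ) (τ : Ω → WithTop ℝ≥0) (R : Ω → ℝ) (t : ℝ≥0) (ω : ℕ → Ω) : ℝ :=
  onWorkload J τ R (ω (onIndex J τ R ω t))
    (t - (onEpoch J τ R ω (onIndex J τ R ω t)).toNNReal)

end Cycle

/-- `π` is the steady-state law of the process `Y`: along almost every path the proportion of
time that `Y` spends in the different states converges weakly to `π`. -/
def IsSteadyStateLaw {S : Type*} [MeasurableSpace S] (Q : Measure S) (Y : ℝ≥0 → S → ℝ)
    (π : ProbabilityMeasure ℝ) : Prop :=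
  ∀ f : ℝ →ᵇ ℝ, ∀ᵐ ω ∂Q,
    Tendsto (fun t : ℝ => t⁻¹ * ∫ s in (0 : ℝ)..t, f (Y s.toNNReal ω)) atTop
      (𝓝 (∫ x, f x ∂(π : Measure ℝ)))

/-- The steady-state law of the on-period workload of the regenerative storage system whose
cycles are independent copies of the first one, which is described by `(J, τ, R)` under `P`. -/
def IsOnSteadyState {Ω : Type*} [MeasurableSpace Ω] (P : Measure Ω) (J : ℝ≥0 → Ω → ℝ)
    (τ : Ω → WithTop ℝ≥0) (R : Ω → ℝ) (π : ProbabilityMeasure ℝ) : Prop :=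
  IsSteadyStateLaw (Measure.infinitePi fun _ : ℕ => P) (onProcess J τ R) π

/-- `(1 - exp (-α v)) / (α r - η α)`, with its limit `v / (r - ρ)` as value at `α = 0`. -/
def onTransform (η : ℝ → ℝ) (ρ α v r : ℝ) : ℝ :=
  if α = 0 then v / (r - ρ) else (1 - Real.exp (-α * v)) / (α * r - η α)

/-- The size-biased measure `A ↦ E[V / (R - ρ) 1_A] / E[V / (R - ρ)]`. -/
def sizeBiased {Ω : Type*} [MeasurableSpace Ω] (P : Measure Ω) (ρ : ℝ) (V R : Ω → ℝ) :
    Measure Ω :=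
  (∫⁻ ω, ENNReal.ofReal (V ω / (R ω - ρ)) ∂P)⁻¹ •
    P.withDensity fun ω => ENNReal.ofReal (V ω / (R ω - ρ))

/-- The random variables of the decomposition: `U` is uniform on `[0, 1]`; given `(V, R)`,
`N + 1` is geometric on `{1, 2, …}` with success probability `1 - ρ / R`; the `e i` are
nonnegative with transform `η α / (ρ α)`; and `U, e 0, e 1, …, (V, R, N)` are independent. -/
structure IsDecomposition {Ω : Type*} [MeasurableSpace Ω] (P : Measure Ω) (η : ℝ → ℝ) (ρ : ℝ)
    (V R U : Ω → ℝ) (N : Ω → ℕ) (e : ℕ → Ω → ℝ) : Prop where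
  measurable_V : Measurable V
  measurable_R : Measurable R
  measurable_U : Measurable U
  measurable_N : Measurable N
  measurable_e : ∀ i, Measurable (e i)
  uniform : P.map U = volume.restrict (Set.Icc (0 : ℝ) 1)
  geometric : ∀ n : ℕ,
    P⟦N ⁻¹' {n} | MeasurableSpace.comap (fun ω => (V ω, R ω)) inferInstance⟧
      =ᵐ[P] fun ω => (1 - ρ / R ω) * (ρ / R ω) ^ n
  e_nonneg : ∀ i, ∀ᵐ ω ∂P, 0 ≤ e i ω
  e_lst : ∀ i, ∀ α : ℝ, 0 < α → ∫ ω, Real.exp (-α * e i ω) ∂P = η α / (ρ * α)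
  indep_e : iIndepFun e P
  indep_U_e : IndepFun U (fun ω i => e i ω) P
  indep_VRN : IndepFun (fun ω => (U ω, fun i => e i ω)) (fun ω => (V ω, R ω, N ω)) P

end

end LevyStorage

namespace LevyStorage

open MeasureTheory.Filtration

noncomputable section

lemma lintegral_mul_eq_of_forall_setLIntegral_eq {Ω : Type*} {m mΩ : MeasurableSpace Ω}
    {P : Measure Ω} (hm : m ≤ mΩ) {f g : Ω → ℝ≥0∞} (hf : AEMeasurable f P) (hg : AEMeasurable g P)
    (h : ∀ s, MeasurableSet[m] s → ∫⁻ ω in s, f ω ∂P = ∫⁻ ω in s, g ω ∂P)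
    {Z : Ω → ℝ≥0∞} (hZ : Measurable[m] Z) :
    ∫⁻ ω, Z ω * f ω ∂P = ∫⁻ ω, Z ω * g ω ∂P := by
  have key : ∀ u : Ω → ℝ≥0∞, AEMeasurable u P →
      ∫⁻ ω, Z ω * u ω ∂P = ∫⁻ ω, Z ω ∂((P.withDensity u).trim hm) := fun u hu => by
    rw [lintegral_trim hm hZ, lintegral_withDensity_eq_lintegral_mul₀ hu
      (hZ.mono hm le_rfl).aemeasurable]
    simp only [Pi.mul_apply, mul_comm]
  rw [key f hf, key g hg]
  congr 1
  refine @Measure.ext _ m _ _ fun s hs => ?_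
  rw [trim_measurableSet_eq hm hs, trim_measurableSet_eq hm hs, withDensity_apply _ (hm s hs),
    withDensity_apply _ (hm s hs), h s hs]

section Grid

/-- The first point strictly after `t` of the grid of mesh `1 / (n + 1)`. -/
def upperGrid (n : ℕ) (t : ℝ≥0) : ℝ≥0 := (⌊(n + 1 : ℝ≥0) * t⌋₊ + 1 : ℕ) / (n + 1 : ℝ≥0)

/-- The last point before `t`, possibly `t` itself, of the grid of mesh `1 / (n + 1)`. -/
def lowerGrid (n : ℕ) (t : ℝ≥0) : ℝ≥0 := (⌊(n + 1 : ℝ≥0) * t⌋₊ : ℕ) / (n + 1 : ℝ≥0)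

lemma lowerGrid_le (n : ℕ) (t : ℝ≥0) : lowerGrid n t ≤ t := by
  rw [lowerGrid, div_le_iff₀ (by positivity), mul_comm t]
  exact Nat.floor_le (by positivity)

lemma upperGrid_le_iff (n : ℕ) (s t : ℝ≥0) : upperGrid n s ≤ t ↔ s < lowerGrid n t := by
  rw [upperGrid, lowerGrid, div_le_iff₀ (by positivity), lt_div_iff₀ (by positivity), mul_comm t,
    mul_comm s, ← Nat.le_floor_iff (by positivity), Nat.add_one_le_iff,
    Nat.floor_lt (by positivity)]

lemma tendsto_upperGrid (t : ℝ≥0) : Tendsto (fun n => upperGrid n t) atTop (𝓝[>] t) := by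
  have lt_upperGrid : ∀ n, t < upperGrid n t := fun n =>
    lt_of_not_ge fun h => ((upperGrid_le_iff n t t).1 h).not_ge (lowerGrid_le n t)
  have upperGrid_le : ∀ n : ℕ, upperGrid n t ≤ t + (n + 1 : ℝ≥0)⁻¹ := fun n => by
    rw [upperGrid, Nat.cast_add_one, add_div, one_div]
    exact add_le_add_left (lowerGrid_le n t) _
  refine tendsto_nhdsWithin_iff.2 ⟨tendsto_of_tendsto_of_tendsto_of_le_of_le tendsto_const_nhds ?_
    (fun n => (lt_upperGrid n).le) upperGrid_le, Eventually.of_forall lt_upperGrid⟩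
  have : Tendsto (fun n : ℕ => ((n : ℝ≥0) + 1)⁻¹) atTop (𝓝 0) := by
    simpa only [one_div] using tendsto_one_div_add_atTop_nhds_zero_nat (𝕜 := ℝ≥0)
  simpa using this.const_add t

variable {Ω : Type*} {κ : Ω → WithTop ℝ≥0} {t : ℝ≥0}

/-- The first point of the grid of mesh `1 / (n + 1)` strictly after `κ`, capped at `t`. -/
def gridTime (κ : Ω → WithTop ℝ≥0) (t : ℝ≥0) (n : ℕ) (ω : Ω) : ℝ≥0 :=
  if κ ω < t then min (upperGrid n (κ ω).untopA) t else t

lemma gridTime_le (n : ℕ) (ω : Ω) : gridTime κ t n ω ≤ t := by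
  unfold gridTime
  split_ifs
  exacts [min_le_right _ _, le_rfl]

lemma gridTime_le_iff {i : ℝ≥0} (hi : i < t) (n : ℕ) (ω : Ω) :
    gridTime κ t n ω ≤ i ↔ κ ω < lowerGrid n i := by
  unfold gridTime
  split_ifs with h
  · lift κ ω to ℝ≥0 using ne_top_of_lt h with k
    simp only [WithTop.untopD_coe, min_le_iff, hi.not_ge, or_false, upperGrid_le_iff,
      WithTop.coe_lt_coe]
  · refine iff_of_false hi.not_ge fun h' => h (h'.trans ?_)
    exact WithTop.coe_lt_coe.2 ((lowerGrid_le n i).trans_lt hi)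

lemma countable_range_gridTime (n : ℕ) :
    (Set.range fun ω => (gridTime κ t n ω : WithTop ℝ≥0)).Countable := by
  refine (Set.countable_range fun k : Option ℕ => (k.elim t fun k =>
    min ((k + 1 : ℕ) / (n + 1 : ℝ≥0)) t : ℝ≥0)).image WithTop.some |>.mono ?_
  rintro _ ⟨ω, rfl⟩
  refine Set.mem_image_of_mem _ ?_
  unfold gridTime upperGrid
  split_ifs
  exacts [⟨some _, rfl⟩, ⟨none, rfl⟩]

lemma tendsto_gridTime {M : ℝ≥0 → Ω → ℝ}
    (hc : ∀ ω t, ContinuousWithinAt (fun s => M s ω) (Set.Ioi t) t) (ω : Ω) :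
    Tendsto (fun n => M (gridTime κ t n ω) ω) atTop (𝓝 (stoppedProcess M κ t ω)) := by
  unfold stoppedProcess gridTime
  split_ifs with h
  · rw [min_eq_right h.le]
    lift κ ω to ℝ≥0 using ne_top_of_lt h with k
    have hk : ∀ᶠ n in atTop, upperGrid n k < t := (tendsto_upperGrid k).eventually
      (nhdsWithin_le_nhds (gt_mem_nhds (WithTop.coe_lt_coe.1 h)))
    refine ((hc ω k).tendsto.comp (tendsto_upperGrid k)).congr' ?_
    filter_upwards [hk] with n hn
    simp only [Function.comp_apply, WithTop.untopD_coe, min_eq_left hn.le]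
  · rw [min_eq_left (not_lt.1 h)]
    exact tendsto_const_nhds

end Grid

section GridSampling

variable {Ω : Type*} [mΩ : MeasurableSpace Ω]

lemma measurable_uncurry_of_rightCont {X : ℝ≥0 → Ω → ℝ} (hX : ∀ t, Measurable (X t))
    (hc : ∀ ω t, ContinuousWithinAt (fun s => X s ω) (Set.Ioi t) t) :
    Measurable (Function.uncurry X) := by
  refine measurable_of_tendsto_metrizable (f := fun n (p : ℝ≥0 × Ω) => X (upperGrid n p.1) p.2)
    (fun n => ?_) (tendsto_pi_nhds.2 fun p => (hc p.2 p.1).tendsto.comp (tendsto_upperGrid p.1))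
  have h : Measurable fun p : ℕ × Ω => X ((p.1 + 1 : ℕ) / (n + 1 : ℝ≥0)) p.2 :=
    measurable_from_prod_countable_right fun k => hX ((k + 1 : ℕ) / (n + 1 : ℝ≥0))
  exact h.comp (by fun_prop : Measurable fun p : ℝ≥0 × Ω => (⌊(n + 1 : ℝ≥0) * p.1⌋₊, p.2))

variable {F : Filtration ℝ≥0 mΩ} {κ : Ω → WithTop ℝ≥0} {M : ℝ≥0 → Ω → ℝ} {t : ℝ≥0}

lemma rightCont_le_of_lt (F : Filtration ℝ≥0 mΩ) {s t : ℝ≥0} (h : s < t) : F₊ s ≤ F t := by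
  rw [Filtration.rightCont_eq]
  exact iInf₂_le t h

lemma measurableSet_inter_lt (hκ : IsStoppingTime F₊ κ) {A : Set Ω}
    (hA : MeasurableSet[hκ.measurableSpace] A) (t : ℝ≥0) :
    MeasurableSet[F t] (A ∩ {ω | κ ω < t}) := by
  have : A ∩ {ω | κ ω < t} =
      ⋃ (q : ℕ) (_ : TopologicalSpace.denseSeq ℝ≥0 q < t),
        A ∩ {ω | κ ω ≤ TopologicalSpace.denseSeq ℝ≥0 q} := by
    ext ω
    simp only [Set.mem_inter_iff, Set.mem_ofPred_eq, Set.mem_iUnion, exists_prop]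
    refine ⟨fun ⟨hω, h⟩ => ?_, fun ⟨q, hq, hω, h⟩ => ⟨hω, h.trans_lt (WithTop.coe_lt_coe.2 hq)⟩⟩
    lift κ ω to ℝ≥0 using ne_top_of_lt h with k
    obtain ⟨q, hq⟩ := (TopologicalSpace.denseRange_denseSeq ℝ≥0).exists_mem_open isOpen_Ioo
      (Set.nonempty_Ioo.2 (WithTop.coe_lt_coe.1 h))
    exact ⟨q, hq.2, hω, WithTop.coe_le_coe.2 hq.1.le⟩
  rw [this]
  exact MeasurableSet.iUnion fun q => MeasurableSet.iUnion fun hq =>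
    rightCont_le_of_lt F hq _ (((hκ.measurableSet A).1 hA).2 _)

lemma measurableSet_inter_gridTime_le (hκ : IsStoppingTime F₊ κ) {A : Set Ω}
    (hA : MeasurableSet[hκ.measurableSpace] A) (n : ℕ) (i : ℝ≥0) :
    MeasurableSet[F i] (A ∩ {ω | κ ω < t} ∩ {ω | gridTime κ t n ω ≤ i}) := by
  rcases lt_or_ge i t with hi | hi
  · have hle := lowerGrid_le n i
    have : A ∩ {ω | κ ω < t} ∩ {ω | gridTime κ t n ω ≤ i} = A ∩ {ω | κ ω < lowerGrid n i} := by
      ext ω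
      simp only [Set.mem_inter_iff, Set.mem_ofPred_eq, gridTime_le_iff hi, and_assoc,
        and_congr_right_iff, and_iff_right_iff_imp]
      exact fun _ h => h.trans (WithTop.coe_lt_coe.2 (hle.trans_lt hi))
    rw [this]
    exact F.mono hle _ (measurableSet_inter_lt hκ hA _)
  · have : {ω | gridTime κ t n ω ≤ i} = Set.univ :=
      Set.eq_univ_of_forall fun ω => (gridTime_le n ω).trans hi
    rw [this, Set.inter_univ]
    exact F.mono hi _ (measurableSet_inter_lt hκ hA _)

lemma isStoppingTime_gridTime (hκ : IsStoppingTime F₊ κ) (n : ℕ) :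
    IsStoppingTime F fun ω => (gridTime κ t n ω : WithTop ℝ≥0) := fun i => by
  simp only [WithTop.coe_le_coe]
  rcases lt_or_ge i t with hi | hi
  · simp only [gridTime_le_iff hi]
    simpa using F.mono (lowerGrid_le n i) _ (measurableSet_inter_lt hκ MeasurableSet.univ _)
  · simpa only [(gridTime_le n _).trans hi, Set.ofPred_true] using MeasurableSet.univ

end GridSampling

section OptionalSampling

variable {Ω : Type*} [mΩ : MeasurableSpace Ω] {P : Measure Ω} [IsFiniteMeasure P]
  {F : Filtration ℝ≥0 mΩ} {κ : Ω → WithTop ℝ≥0} {M : ℝ≥0 → Ω → ℝ} {t : ℝ≥0}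

lemma gridTime_ae_eq_condExp (hM : Martingale M F P) (hκ : IsStoppingTime F₊ κ) (n : ℕ) :
    (fun ω => M (gridTime κ t n ω) ω)
      =ᵐ[P] P[M t | (isStoppingTime_gridTime (t := t) hκ n).measurableSpace] :=
  hM.stoppedValue_ae_eq_condExp_of_le_const_of_countable_range _
    (fun ω => WithTop.coe_le_coe.2 (gridTime_le n ω)) (countable_range_gridTime n)

lemma unifIntegrable_gridTime (hM : Martingale M F P) (hκ : IsStoppingTime F₊ κ) :
    UniformIntegrable (fun n ω => M (gridTime κ t n ω) ω) 1 P :=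
  ((hM.integrable t).uniformIntegrable_condExp fun n =>
    (isStoppingTime_gridTime (t := t) hκ n).measurableSpace_le).ae_eq
    fun n => (gridTime_ae_eq_condExp hM hκ n).symm

lemma setIntegral_gridTime (hM : Martingale M F P) (hκ : IsStoppingTime F₊ κ) {A : Set Ω}
    (hA : MeasurableSet[hκ.measurableSpace] A) (n : ℕ) :
    ∫ ω in A ∩ {ω | κ ω < t}, M (gridTime κ t n ω) ω ∂P = ∫ ω in A ∩ {ω | κ ω < t}, M t ω ∂P := by
  have hg := isStoppingTime_gridTime (t := t) hκ n
  have hAg : MeasurableSet[hg.measurableSpace] (A ∩ {ω | κ ω < t}) := by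
    refine (hg.measurableSet _).2 ⟨?_, fun i => ?_⟩
    · exact le_iSup F t _ (measurableSet_inter_lt hκ hA t)
    · simpa only [WithTop.coe_le_coe] using measurableSet_inter_gridTime_le hκ hA n i
  rw [← setIntegral_condExp hg.measurableSpace_le (hM.integrable t) hAg]
  exact integral_congr_ae (ae_restrict_of_ae (gridTime_ae_eq_condExp hM hκ n))

lemma integrable_stoppedProcess (hM : Martingale M F P)
    (hc : ∀ ω t, ContinuousWithinAt (fun s => M s ω) (Set.Ioi t) t)
    (hκ : IsStoppingTime F₊ κ) (t : ℝ≥0) : Integrable (stoppedProcess M κ t) P :=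
  (unifIntegrable_gridTime hM hκ).integrable_of_ae_tendsto
    (ae_of_all P (tendsto_gridTime hc))

lemma setIntegral_stoppedProcess (hM : Martingale M F P)
    (hc : ∀ ω t, ContinuousWithinAt (fun s => M s ω) (Set.Ioi t) t)
    (hκ : IsStoppingTime F₊ κ) {A : Set Ω} (hA : MeasurableSet[hκ.measurableSpace] A)
    (t : ℝ≥0) :
    ∫ ω in A, stoppedProcess M κ t ω ∂P = ∫ ω in A, M t ω ∂P := by
  have hlt : ∫ ω in A ∩ {ω | κ ω < t}, stoppedProcess M κ t ω ∂P
      = ∫ ω in A ∩ {ω | κ ω < t}, M t ω ∂P := by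
    have hu := unifIntegrable_gridTime (t := t) hM hκ
    have hi := integrable_stoppedProcess hM hc hκ t
    refine tendsto_nhds_unique (tendsto_setIntegral_of_L1' _ hi.1
      (Eventually.of_forall fun n => hu.memLp n |>.integrable le_rfl)
      (tendsto_Lp_finite_of_tendsto_ae le_rfl ENNReal.one_ne_top hu.1
        (memLp_one_iff_integrable.2 hi) hu.2.1 (ae_of_all P (tendsto_gridTime hc))) _) ?_
    simp only [setIntegral_gridTime hM hκ hA, tendsto_const_nhds]
  have hge : ∫ ω in A \ {ω | κ ω < t}, stoppedProcess M κ t ω ∂P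
      = ∫ ω in A \ {ω | κ ω < t}, M t ω ∂P := by
    have hm : MeasurableSet (A \ {ω | κ ω < t}) := (hκ.measurableSpace_le _ hA).diff
      (hκ.measurableSpace_le _ (hκ.measurableSet_lt' t))
    refine setIntegral_congr_fun hm fun ω hω => ?_
    have : (t : WithTop ℝ≥0) ≤ κ ω := not_lt.1 hω.2
    simp only [stoppedProcess, min_eq_left this, WithTop.untopD_coe]
  have hm := hκ.measurableSpace_le _ (hκ.measurableSet_lt' t)
  rw [← integral_inter_add_sdiff hm (integrable_stoppedProcess hM hc hκ t).integrableOn,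
    ← integral_inter_add_sdiff hm (hM.integrable t).integrableOn, hlt, hge]

lemma lintegral_stoppedProcess (hM : Martingale M F P) (hM0 : ∀ t ω, 0 ≤ M t ω)
    (hc : ∀ ω t, ContinuousWithinAt (fun s => M s ω) (Set.Ioi t) t)
    (hκ : IsStoppingTime F₊ κ) (t : ℝ≥0) {Z : Ω → ℝ≥0∞} (hZ : Measurable[hκ.measurableSpace] Z) :
    ∫⁻ ω, Z ω * ENNReal.ofReal (stoppedProcess M κ t ω) ∂P =
      ∫⁻ ω, Z ω * ENNReal.ofReal (M t ω) ∂P := by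
  have hi := integrable_stoppedProcess hM hc hκ t
  refine lintegral_mul_eq_of_forall_setLIntegral_eq hκ.measurableSpace_le
    hi.1.aemeasurable.ennreal_ofReal (hM.integrable t).1.aemeasurable.ennreal_ofReal
    (fun A hA => ?_) hZ
  rw [← ofReal_integral_eq_lintegral_ofReal hi.integrableOn (ae_of_all _ fun ω => hM0 _ ω),
    ← ofReal_integral_eq_lintegral_ofReal (hM.integrable t).integrableOn (ae_of_all _ (hM0 t)),
    setIntegral_stoppedProcess hM hc hκ hA]

end OptionalSampling

section Subordinator

lemma one_sub_exp_div_nonneg {α x : ℝ} (hα : 0 < α) (hx : 0 ≤ x) :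
    0 ≤ (1 - Real.exp (-α * x)) / α := by
  refine div_nonneg (sub_nonneg.2 (Real.exp_le_one_iff.2 ?_)) hα.le
  nlinarith

lemma one_sub_exp_div_le {α : ℝ} (hα : 0 < α) (x : ℝ) : (1 - Real.exp (-α * x)) / α ≤ x := by
  rw [div_le_iff₀ hα]
  linarith [Real.add_one_le_exp (-α * x)]

lemma tendsto_one_sub_exp_div (x : ℝ) :
    Tendsto (fun α => (1 - Real.exp (-α * x)) / α) (𝓝[>] 0) (𝓝 x) := by
  have hd : HasDerivAt (fun α : ℝ => 1 - Real.exp (-α * x)) x 0 := by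
    simpa using (((hasDerivAt_id (0 : ℝ)).neg.mul_const x).exp).const_sub 1
  refine ((hasDerivAt_iff_tendsto_slope_zero.1 hd).mono_left
    (nhdsWithin_mono 0 fun _ h => ne_of_gt h)).congr fun α => ?_
  simp [div_eq_inv_mul]

lemma map_eq_mul_map_one_of_monotone (f : ℝ≥0 →+ ℝ) (hf : Monotone f) (t : ℝ≥0) :
    f t = t * f 1 := by
  have hnat : ∀ n : ℕ, f n = n * f 1 := fun n => by
    rw [← nsmul_one, map_nsmul, nsmul_eq_mul]
  have hbound : ∀ n : ℕ, n * |f t - t * f 1| ≤ f 1 := fun n => by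
    have hmul : f (n * t) = n * f t := by rw [← nsmul_eq_mul, map_nsmul, nsmul_eq_mul]
    have hlow := hf (Nat.floor_le (zero_le : 0 ≤ (n : ℝ≥0) * t))
    have hupp := hf (Nat.lt_floor_add_one ((n : ℝ≥0) * t)).le
    have hfl : (⌊(n : ℝ≥0) * t⌋₊ : ℝ) ≤ n * t := mod_cast Nat.floor_le (zero_le : 0 ≤ (n : ℝ≥0) * t)
    have hfu : (n * t : ℝ) ≤ ⌊(n : ℝ≥0) * t⌋₊ + 1 :=
      mod_cast (Nat.lt_floor_add_one ((n : ℝ≥0) * t)).le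
    have h1 : 0 ≤ f 1 := by simpa using hf (zero_le : (0 : ℝ≥0) ≤ 1)
    rw [← Nat.cast_add_one] at hupp
    rw [hnat, hmul] at hlow hupp
    push_cast at hupp
    rw [← abs_of_nonneg (Nat.cast_nonneg n : (0 : ℝ) ≤ n), ← abs_mul, abs_le]
    constructor <;> nlinarith
  by_contra hne
  obtain ⟨n, hn⟩ := Archimedean.arch (f 1 + 1) (abs_pos.2 (sub_ne_zero.2 hne))
  rw [nsmul_eq_mul] at hn
  linarith [hbound n]

variable {Ω : Type*} [mΩ : MeasurableSpace Ω] {P : Measure Ω} {F : Filtration ℝ≥0 mΩ}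
  {J : ℝ≥0 → Ω → ℝ} {α : ℝ}

/-- The Wald exponential martingale of a subordinator. -/
def wald (P : Measure Ω) (J : ℝ≥0 → Ω → ℝ) (α : ℝ) (t : ℝ≥0) (ω : Ω) : ℝ :=
  Real.exp (exponent P J α * t) * Real.exp (-α * J t ω)

namespace IsSubordinator

lemma measurable (hJ : IsSubordinator P F J) (t : ℝ≥0) : Measurable (J t) :=
  (hJ.adapted t).mono (F.le t) le_rfl

lemma nonneg (hJ : IsSubordinator P F J) (t : ℝ≥0) (ω : Ω) : 0 ≤ J t ω :=
  (hJ.zero ω).symm.le.trans (hJ.mono ω (zero_le : 0 ≤ t))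

lemma exp_le_one (hJ : IsSubordinator P F J) (hα : 0 ≤ α) (t : ℝ≥0) (ω : Ω) :
    Real.exp (-α * J t ω) ≤ 1 := by
  rw [Real.exp_le_one_iff]
  nlinarith [hJ.nonneg t ω]

lemma continuousWithinAt_wald (hJ : IsSubordinator P F J) (α : ℝ) (ω : Ω) (t : ℝ≥0) :
    ContinuousWithinAt (fun s => wald P J α s ω) (Set.Ioi t) t :=
  (Continuous.continuousWithinAt (by fun_prop)).mul ((hJ.rightCont ω t).const_mul (-α)).rexp

variable [IsProbabilityMeasure P]

lemma integrable_exp (hJ : IsSubordinator P F J) (hα : 0 ≤ α) (t : ℝ≥0) :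
    Integrable (fun ω => Real.exp (-α * J t ω)) P :=
  Integrable.of_bound ((hJ.measurable t).const_mul _).exp.aestronglyMeasurable 1
    (ae_of_all _ fun ω => by simpa [abs_of_pos (Real.exp_pos _)] using hJ.exp_le_one hα t ω)

lemma condExp_exp_add (hJ : IsSubordinator P F J) (hα : 0 ≤ α) (s h : ℝ≥0) :
    P[fun ω => Real.exp (-α * J (s + h) ω) | F s] =ᵐ[P]
      fun ω => Real.exp (-α * J s ω) * mgf (J h) P (-α) := by
  let increment : Ω → ℝ := fun ω => J (s + h) ω - J s ω
  have hincr : Measurable increment := (hJ.measurable _).sub (hJ.measurable _)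
  have hfactor : (fun ω => Real.exp (-α * J (s + h) ω)) =
      (fun ω => Real.exp (-α * J s ω)) * fun ω => Real.exp (-α * increment ω) := by
    ext ω
    simp only [Pi.mul_apply, ← Real.exp_add, increment]
    ring_nf
  have hint : Integrable (fun ω => Real.exp (-α * increment ω)) P :=
    ((hJ.stationary s h).comp (by fun_prop : Measurable fun x : ℝ => Real.exp (-α * x))
      ).integrable_iff.2 (hJ.integrable_exp hα h)
  have hindep := condExp_indep_eq (f := fun ω => Real.exp (-α * increment ω))
    hincr.comap_le (F.le s)
    ((comap_measurable increment).const_mul (-α)).exp.stronglyMeasurable (hJ.indep s h)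
  have hmgf : ∫ ω, Real.exp (-α * increment ω) ∂P = mgf (J h) P (-α) :=
    congrFun (mgf_congr_identDistrib (hJ.stationary s h)) (-α)
  rw [hfactor]
  filter_upwards [condExp_mul_of_stronglyMeasurable_left
    ((hJ.adapted s).const_mul (-α)).exp.stronglyMeasurable
    (hfactor ▸ hJ.integrable_exp hα (s + h)) hint, hindep] with ω hpull hω
  rw [hpull, Pi.mul_apply, hω, hmgf]

lemma mgf_add (hJ : IsSubordinator P F J) (hα : 0 ≤ α) (s h : ℝ≥0) :
    mgf (J (s + h)) P (-α) = mgf (J s) P (-α) * mgf (J h) P (-α) := by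
  rw [mgf, ← integral_condExp (F.le s), integral_congr_ae (hJ.condExp_exp_add hα s h),
    integral_mul_const, mgf, mgf]

lemma mgf_eq (hJ : IsSubordinator P F J) (hα : 0 ≤ α) (t : ℝ≥0) :
    mgf (J t) P (-α) = Real.exp (-exponent P J α * t) := by
  have hpos : ∀ t, 0 < mgf (J t) P (-α) := fun t => mgf_pos (hJ.integrable_exp hα t)
  have hzero : J 0 = 0 := funext hJ.zero
  let cumulant : ℝ≥0 →+ ℝ :=
    { toFun := fun t => -Real.log (mgf (J t) P (-α))
      map_zero' := by simp [hzero, mgf_zero_fun]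
      map_add' := fun s t => by
        rw [hJ.mgf_add hα, Real.log_mul (hpos s).ne' (hpos t).ne', neg_add] }
  have hmono : Monotone cumulant := fun s t hst => by
    refine neg_le_neg (Real.log_le_log (hpos t)
      (integral_mono (hJ.integrable_exp hα t) (hJ.integrable_exp hα s) fun ω => ?_))
    exact Real.exp_le_exp.2 (by nlinarith [hJ.mono ω hst])
  have hlinear : -Real.log (mgf (J t) P (-α)) = t * exponent P J α :=
    map_eq_mul_map_one_of_monotone cumulant hmono t
  rw [← Real.exp_log (hpos t)]
  congr 1
  linarith

lemma exponent_le (hJ : IsSubordinator P F J) (hJm : Integrable (J 1) P) (hα : 0 ≤ α) :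
    exponent P J α ≤ α * meanRate P J := by
  have hjensen := convexOn_exp.map_integral_le Real.continuous_exp.continuousOn isClosed_univ
    (ae_of_all P fun _ => Set.mem_univ _) (hJm.const_mul (-α)) (hJ.integrable_exp hα 1)
  have h := hJ.mgf_eq hα 1
  rw [integral_const_mul] at hjensen
  have := Real.exp_le_exp.1 (hjensen.trans_eq h)
  rw [NNReal.coe_one] at this
  simp only [meanRate]
  linarith

lemma tendsto_exponent_div (hJ : IsSubordinator P F J) (hJm : Integrable (J 1) P) :
    Tendsto (fun α => exponent P J α / α) (𝓝[>] 0) (𝓝 (meanRate P J)) := by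
  have hlow : Tendsto (fun α => ∫ ω, (1 - Real.exp (-α * J 1 ω)) / α ∂P) (𝓝[>] 0)
      (𝓝 (meanRate P J)) := by
    refine tendsto_integral_filter_of_dominated_convergence (J 1) (Eventually.of_forall fun α =>
      ((((hJ.measurable 1).const_mul _).exp.const_sub _).div_const _).aestronglyMeasurable)
      ?_ hJm (ae_of_all P fun ω => tendsto_one_sub_exp_div _)
    filter_upwards [self_mem_nhdsWithin] with α hα
    refine ae_of_all P fun ω => ?_
    rw [Real.norm_of_nonneg (one_sub_exp_div_nonneg hα (hJ.nonneg 1 ω))]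
    exact one_sub_exp_div_le hα _
  refine tendsto_of_tendsto_of_tendsto_of_le_of_le' hlow tendsto_const_nhds ?_ ?_
  · filter_upwards [self_mem_nhdsWithin] with α hα
    have hpos := mgf_pos (hJ.integrable_exp (le_of_lt hα) 1)
    rw [integral_div, integral_sub (integrable_const _) (hJ.integrable_exp (le_of_lt hα) 1),
      integral_const, probReal_univ, one_smul]
    refine div_le_div_of_nonneg_right ?_ (le_of_lt hα)
    have := Real.log_le_sub_one_of_pos hpos
    simp only [exponent, mgf] at this ⊢
    linarith
  · filter_upwards [self_mem_nhdsWithin] with α hα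
    rw [div_le_iff₀ hα, mul_comm]
    exact hJ.exponent_le hJm (le_of_lt hα)

lemma martingale_wald (hJ : IsSubordinator P F J) (hα : 0 ≤ α) :
    Martingale (wald P J α) F P := by
  refine ⟨fun t => (((hJ.adapted t).const_mul (-α)).exp.const_mul _).stronglyMeasurable,
    fun s t hst => ?_⟩
  obtain ⟨h, rfl⟩ := exists_add_of_le hst
  filter_upwards [condExp_smul (Real.exp (exponent P J α * (s + h : ℝ≥0)))
    (fun ω => Real.exp (-α * J (s + h) ω)) (F s), hJ.condExp_exp_add hα s h] with ω hsmul hω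
  refine hsmul.trans ?_
  rw [Pi.smul_apply, hω, hJ.mgf_eq hα, wald, smul_eq_mul, ← Real.exp_add, ← Real.exp_add,
    ← Real.exp_add]
  push_cast
  ring_nf

end IsSubordinator

end Subordinator

section TimeMeasure

/-- Lebesgue measure on the time axis `[0, ∞)`. -/
def timeMeasure : Measure ℝ≥0 := (volume : Measure ℝ).comap (↑)

lemma measurableEmbedding_coe : MeasurableEmbedding ((↑) : ℝ≥0 → ℝ) :=
  MeasurableEmbedding.subtype_coe measurableSet_Ici

lemma image_coe_Iio (t : ℝ≥0) : ((↑) : ℝ≥0 → ℝ) '' Set.Iio t = Set.Ico 0 (t : ℝ) := by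
  ext x
  exact ⟨by rintro ⟨s, hs, rfl⟩; exact ⟨s.2, hs⟩, fun hx => ⟨⟨x, hx.1⟩, hx.2, rfl⟩⟩

lemma timeMeasure_Iio (t : ℝ≥0) : timeMeasure (Set.Iio t) = t := by
  rw [timeMeasure, measurableEmbedding_coe.comap_apply, image_coe_Iio, Real.volume_Ico, sub_zero,
    ENNReal.ofReal_coe_nnreal]

instance : SigmaFinite timeMeasure where
  out' := ⟨{
    set := fun n => Set.Iio n
    set_mem := fun _ => trivial
    finite := fun n => by simpa only [timeMeasure_Iio] using ENNReal.coe_lt_top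
    spanning := Set.iUnion_eq_univ_iff.2 fun t => exists_nat_gt t }⟩

lemma timeMeasure_univ : timeMeasure Set.univ = ∞ :=
  ENNReal.eq_top_of_forall_nnreal_le fun t =>
    (timeMeasure_Iio t).symm.le.trans (measure_mono (Set.subset_univ _))

lemma timeMeasure_lt (S : ℝ≥0∞) : timeMeasure {t | (t : ℝ≥0∞) < S} = S := by
  cases S with
  | top => simpa only [ENNReal.coe_lt_top, Set.ofPred_true] using timeMeasure_univ
  | coe S => simpa only [ENNReal.coe_lt_coe, Set.Iio_def] using timeMeasure_Iio S

lemma map_coe_restrict_timeMeasure (s : Set ℝ≥0) :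
    (timeMeasure.restrict s).map (↑) = (volume : Measure ℝ).restrict ((↑) '' s) := by
  rw [timeMeasure, measurableEmbedding_coe.restrict_comap, measurableEmbedding_coe.map_comap,
    Measure.restrict_restrict measurableEmbedding_coe.measurableSet_range,
    Set.inter_eq_right.2 (Set.image_subset_range _ _)]

lemma setLIntegral_timeMeasure (s : Set ℝ≥0) (f : ℝ≥0 → ℝ≥0∞) :
    ∫⁻ t in s, f t ∂timeMeasure = ∫⁻ x in ((↑) : ℝ≥0 → ℝ) '' s, f x.toNNReal := by
  rw [← map_coe_restrict_timeMeasure, measurableEmbedding_coe.lintegral_map]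
  simp only [Real.toNNReal_coe]

lemma setLIntegral_Ici_timeMeasure (a : ℝ≥0) (f : ℝ≥0 → ℝ≥0∞) :
    ∫⁻ t in Set.Ici a, f t ∂timeMeasure = ∫⁻ s, f (a + s) ∂timeMeasure := by
  have hpre : ((a : ℝ) + ·) ⁻¹' (((↑) : ℝ≥0 → ℝ) '' Set.Ici a) = (↑) '' (Set.univ : Set ℝ≥0) := by
    ext x
    simp
  rw [← setLIntegral_univ (fun s => f (a + s)), setLIntegral_timeMeasure, setLIntegral_timeMeasure,
    ← hpre, ← (measurePreserving_add_left volume (a : ℝ)).setLIntegral_comp_preimage_emb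
      (measurableEmbedding_addLeft _)]
  refine setLIntegral_congr_fun ?_ fun x hx => ?_
  · rw [hpre]
    exact measurableEmbedding_coe.measurableSet_image.2 MeasurableSet.univ
  · obtain ⟨s, -, rfl⟩ := hpre ▸ hx
    simp only [Real.toNNReal_coe, ← NNReal.coe_add]

lemma setLIntegral_Iio_mul_exp {φ : ℝ} (hφ : 0 ≤ φ) (b : ℝ≥0) :
    ∫⁻ s in Set.Iio b, ENNReal.ofReal (φ * Real.exp (φ * s)) ∂timeMeasure =
      ENNReal.ofReal (Real.exp (φ * b) - 1) := by
  have hderiv : ∀ x ∈ Set.uIcc 0 (b : ℝ),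
      HasDerivAt (fun x => Real.exp (φ * x)) (φ * Real.exp (φ * x)) x := fun x _ => by
    simpa [mul_comm] using ((hasDerivAt_id x).const_mul φ).exp
  have hint : IntervalIntegrable (fun x => φ * Real.exp (φ * x)) volume 0 b :=
    Continuous.intervalIntegrable (by fun_prop) _ _
  rw [setLIntegral_timeMeasure, image_coe_Iio, restrict_Ico_eq_restrict_Ioc,
    setLIntegral_congr_fun measurableSet_Ioc fun x hx => by rw [Real.coe_toNNReal x hx.1.le],
    ← ofReal_integral_eq_lintegral_ofReal
      ((intervalIntegrable_iff_integrableOn_Ioc_of_le b.coe_nonneg).1 hint)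
      (ae_of_all _ fun x => mul_nonneg hφ (Real.exp_pos _).le),
    ← intervalIntegral.integral_of_le b.coe_nonneg,
    intervalIntegral.integral_eq_sub_of_hasDerivAt hderiv hint, mul_zero, Real.exp_zero]

lemma intervalIntegral_comp_toNNReal (f : ℝ≥0 → ℝ) (t : ℝ≥0) :
    ∫ s in (0 : ℝ)..t, f s.toNNReal = ∫ s in Set.Iio t, f s ∂timeMeasure := by
  rw [intervalIntegral.integral_of_le t.coe_nonneg, ← restrict_Ico_eq_restrict_Ioc, ← image_coe_Iio,
    ← map_coe_restrict_timeMeasure, measurableEmbedding_coe.integral_map]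
  simp only [Real.toNNReal_coe]

end TimeMeasure

section Path

/-- A right-continuous path that starts in `[0, ∞)` and decreases at rate at most `r`. -/
structure IsWorkloadPath (w : ℝ≥0 → ℝ) (r : ℝ) : Prop where
  rightCont : ∀ t, ContinuousWithinAt w (Set.Ioi t) t
  mono : Monotone fun s : ℝ≥0 => w s + r * s
  zero_nonneg : 0 ≤ w 0

/-- The first passage time of the path `w` below the origin. -/
def passageTime (w : ℝ≥0 → ℝ) : ℝ≥0∞ := ⨅ (s : ℝ≥0) (_ : w s < 0), (s : ℝ≥0∞)

variable {w : ℝ≥0 → ℝ} {r : ℝ} {s t : ℝ≥0}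

lemma nonneg_of_lt_passageTime (h : (s : ℝ≥0∞) < passageTime w) : 0 ≤ w s :=
  le_of_not_gt fun hs => h.not_ge (iInf₂_le s hs)

lemma exists_denseSeq_neg (hw : ContinuousWithinAt w (Set.Ioi s) s) (hs : w s < 0) (hst : s < t) :
    ∃ i, s < TopologicalSpace.denseSeq ℝ≥0 i ∧ TopologicalSpace.denseSeq ℝ≥0 i < t ∧
      w (TopologicalSpace.denseSeq ℝ≥0 i) < 0 := by
  obtain ⟨b, hb, hIoo⟩ := (mem_nhdsGT_iff_exists_Ioo_subset).1 (hw.eventually (gt_mem_nhds hs))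
  obtain ⟨i, hi⟩ := (TopologicalSpace.denseRange_denseSeq ℝ≥0).exists_mem_open
    (isOpen_Ioo (a := s) (b := min b t)) (Set.nonempty_Ioo.2 (lt_min hb hst))
  exact ⟨i, hi.1, hi.2.trans_le (min_le_right _ _), hIoo ⟨hi.1, hi.2.trans_le (min_le_left _ _)⟩⟩

lemma measurable_passageTime {Ω : Type*} [MeasurableSpace Ω] {w : Ω → ℝ≥0 → ℝ}
    (hw : ∀ s, Measurable fun ω => w ω s)
    (hc : ∀ ω s, ContinuousWithinAt (w ω) (Set.Ioi s) s) :
    Measurable fun ω => passageTime (w ω) := by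
  let q := TopologicalSpace.denseSeq ℝ≥0
  refine measurable_of_Iio fun c => ?_
  have hunion : (fun ω => passageTime (w ω)) ⁻¹' Set.Iio c =
      ⋃ i, ⋃ _ : (q i : ℝ≥0∞) < c, {ω | w ω (q i) < 0} := by
    ext ω
    simp only [Set.mem_preimage, Set.mem_Iio, passageTime, iInf_lt_iff, exists_prop,
      Set.mem_iUnion, Set.mem_ofPred_eq]
    refine ⟨fun ⟨s, hs, hsc⟩ => ?_, fun ⟨i, hi, hneg⟩ => ⟨q i, hneg, hi⟩⟩
    obtain ⟨t, hst, htc⟩ := ENNReal.lt_iff_exists_nnreal_btwn.1 hsc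
    obtain ⟨i, -, hi, hneg⟩ := exists_denseSeq_neg (hc ω s) hs (ENNReal.coe_lt_coe.1 hst)
    exact ⟨i, (ENNReal.coe_lt_coe.2 hi).trans htc, hneg⟩
  rw [hunion]
  exact MeasurableSet.iUnion fun i => MeasurableSet.iUnion fun _ =>
    measurableSet_lt (hw (q i)) measurable_const

namespace IsWorkloadPath

lemma sub_le (hw : IsWorkloadPath w r) (hst : s ≤ t) : w s - r * (t - s) ≤ w t := by
  linarith [hw.mono hst]

lemma nonneg_of_le_passageTime (hw : IsWorkloadPath w r) (h : (s : ℝ≥0∞) ≤ passageTime w) :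
    0 ≤ w s := by
  rcases eq_or_ne s 0 with rfl | hs0
  · exact hw.zero_nonneg
  have : (𝓝[<] s).NeBot := nhdsLT_neBot_of_exists_lt ⟨0, pos_iff_ne_zero.2 hs0⟩
  have hlim : Tendsto (fun u : ℝ≥0 => -(r * ((s : ℝ) - u))) (𝓝[<] s) (𝓝 0) := by
    have hc : Continuous fun u : ℝ≥0 => -(r * ((s : ℝ) - u)) := by fun_prop
    simpa using (hc.tendsto s).mono_left nhdsWithin_le_nhds
  refine le_of_tendsto hlim (eventually_mem_nhdsWithin.mono fun u hu => ?_)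
  linarith [hw.sub_le (le_of_lt hu),
    nonneg_of_lt_passageTime ((ENNReal.coe_lt_coe.2 hu).trans_le h)]

lemma eq_zero_of_passageTime_eq (hw : IsWorkloadPath w r) (h : passageTime w = t) : w t = 0 := by
  refine le_antisymm (le_of_not_gt fun hpos => ?_) (hw.nonneg_of_le_passageTime h.ge)
  obtain ⟨b, hb, hIoo⟩ := (mem_nhdsGT_iff_exists_Ioo_subset).1
    ((hw.rightCont t).eventually (lt_mem_nhds hpos))
  have hle : (b : ℝ≥0∞) ≤ passageTime w := by
    refine le_iInf₂ fun s hs => ENNReal.coe_le_coe.2 (le_of_not_gt fun hsb => ?_)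
    rcases lt_trichotomy s t with hst | rfl | hts
    · exact hs.not_ge (nonneg_of_lt_passageTime (h ▸ ENNReal.coe_lt_coe.2 hst))
    · exact hs.not_gt hpos
    · exact hs.not_gt (hIoo ⟨hts, hsb⟩)
  rw [h, ENNReal.coe_le_coe] at hle
  exact hle.not_gt hb

lemma zeroTime_le_passageTime (hw : IsWorkloadPath w r) :
    ⨅ (s : ℝ≥0) (_ : w s = 0), (s : ℝ≥0∞) ≤ passageTime w := by
  cases h : passageTime w with
  | top => exact le_top
  | coe t => exact iInf₂_le t (hw.eq_zero_of_passageTime_eq h)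

end IsWorkloadPath

end Path

section Clock

variable {Ω : Type*} {J : ℝ≥0 → Ω → ℝ} {τ : Ω → WithTop ℝ≥0} {R : Ω → ℝ} {ω : Ω}

/-- The workload `J t - R (t - τ)` as a function of the clock `t` of `J`. -/
def clockWorkload (J : ℝ≥0 → Ω → ℝ) (τ : Ω → WithTop ℝ≥0) (R : Ω → ℝ) (t : ℝ≥0) (ω : Ω) : ℝ :=
  J t ω - R ω * (t - (τ ω).untopA)

/-- The first passage time below the origin of the on-period workload, on the clock of `J`. -/
def clockPassageTime (J : ℝ≥0 → Ω → ℝ) (τ : Ω → WithTop ℝ≥0) (R : Ω → ℝ) (ω : Ω) :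
    WithTop ℝ≥0 :=
  ⨅ (t : ℝ≥0) (_ : τ ω ≤ t ∧ clockWorkload J τ R t ω < 0), (t : WithTop ℝ≥0)

lemma le_clockPassageTime (ω : Ω) : τ ω ≤ clockPassageTime J τ R ω :=
  le_iInf₂ fun _ h => h.1

lemma clockWorkload_nonneg {t : ℝ≥0} (h : τ ω ≤ t) (ht : t < clockPassageTime J τ R ω) :
    0 ≤ clockWorkload J τ R t ω :=
  le_of_not_gt fun hneg => ht.not_ge (iInf₂_le t ⟨h, hneg⟩)

lemma clockPassageTime_lt_iff (t : ℝ≥0) :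
    clockPassageTime J τ R ω < t ↔ ∃ u : ℝ≥0, τ ω ≤ u ∧ u < t ∧ clockWorkload J τ R u ω < 0 := by
  simp only [clockPassageTime, iInf_lt_iff, WithTop.coe_lt_coe, exists_prop]
  grind

lemma clockWorkload_add {a : ℝ≥0} (ha : τ ω = a) (s : ℝ≥0) :
    clockWorkload J τ R (a + s) ω = onWorkload J τ R ω s := by
  simp only [clockWorkload, onWorkload, ha, WithTop.untopD_coe, NNReal.coe_add, add_sub_cancel_left]

lemma clockPassageTime_eq_add {a : ℝ≥0} (ha : τ ω = a) :
    @Eq ℝ≥0∞ (clockPassageTime J τ R ω) (a + passageTime (onWorkload J τ R ω)) := by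
  refine le_antisymm (tsub_le_iff_left.1 (le_iInf₂ fun s hs => tsub_le_iff_left.2 ?_))
    (le_iInf₂ fun t ht => ?_)
  · have hle : ((a : ℝ≥0) : WithTop ℝ≥0) ≤ (a + s : ℝ≥0) := WithTop.coe_le_coe.2 le_self_add
    exact iInf₂_le (a + s) ⟨ha.trans_le hle, (clockWorkload_add ha s).trans_lt hs⟩
  · obtain ⟨s, rfl⟩ := exists_add_of_le (WithTop.coe_le_coe.1 (ha.symm.trans_le ht.1))
    have hneg : onWorkload J τ R ω s < 0 := clockWorkload_add ha s ▸ ht.2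
    exact add_le_add_right (iInf₂_le s hneg) (a : ℝ≥0∞)

lemma clockWorkload_eq_zero {b : ℝ≥0} (hw : IsWorkloadPath (onWorkload J τ R ω) (R ω))
    (hb : clockPassageTime J τ R ω = b) : clockWorkload J τ R b ω = 0 := by
  have hle : τ ω ≤ b := hb ▸ le_clockPassageTime ω
  obtain ⟨a, ha⟩ := WithTop.ne_top_iff_exists.1 (ne_top_of_le_ne_top WithTop.coe_ne_top hle)
  obtain ⟨s, rfl⟩ := exists_add_of_le (WithTop.coe_le_coe.1 (ha.trans_le hle))
  rw [clockWorkload_add ha.symm]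
  refine hw.eq_zero_of_passageTime_eq ((ENNReal.add_right_inj (ENNReal.coe_ne_top (r := a))).1 ?_)
  rw [← ENNReal.coe_add]
  exact (clockPassageTime_eq_add ha.symm).symm.trans hb

end Clock

section ClockStopping

variable {Ω : Type*} [mΩ : MeasurableSpace Ω] {P : Measure Ω} {F : Filtration ℝ≥0 mΩ}
  {J : ℝ≥0 → Ω → ℝ} {τ : Ω → WithTop ℝ≥0} {R : Ω → ℝ}

lemma measurable_indicator_of_isStoppingTime {G : Filtration ℝ≥0 mΩ} (hτ : IsStoppingTime G τ)
    {f : Ω → ℝ} (hf : Measurable[hτ.measurableSpace] f) (t : ℝ≥0) :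
    Measurable[G t] ({ω | τ ω ≤ t}.indicator f) := by
  intro B hB
  rw [Set.indicator_preimage, Set.ite]
  exact ((hf hB).2 t).union (MeasurableSet.diff (measurable_const hB) (hτ t))

lemma IsSubordinator.continuousWithinAt_clockWorkload (hJ : IsSubordinator P F J)
    (τ : Ω → WithTop ℝ≥0) (R : Ω → ℝ) (ω : Ω) (t : ℝ≥0) :
    ContinuousWithinAt (fun s => clockWorkload J τ R s ω) (Set.Ioi t) t :=
  (hJ.rightCont ω t).sub (Continuous.continuousWithinAt (by fun_prop))

lemma IsSubordinator.isWorkloadPath (hJ : IsSubordinator P F J) (τ : Ω → WithTop ℝ≥0)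
    (R : Ω → ℝ) (ω : Ω) : IsWorkloadPath (onWorkload J τ R ω) (R ω) where
  rightCont t := by
    refine ContinuousWithinAt.sub ?_ (Continuous.continuousWithinAt (by fun_prop))
    exact (hJ.rightCont ω _).comp (f := fun s => (τ ω).untopA + s)
      (Continuous.continuousWithinAt (by fun_prop))
      fun s hs => Set.mem_Ioi.2 (add_lt_add_right hs _)
  mono s t hst := by
    have := hJ.mono ω (add_le_add_right hst (τ ω).untopA)
    simpa only [onWorkload, sub_add_cancel] using this
  zero_nonneg := by simpa only [onWorkload, NNReal.coe_zero, mul_zero, sub_zero] using hJ.nonneg _ ω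

lemma measurableSet_clockWorkload_neg (hJ : IsSubordinator P F J) (hτ : IsStoppingTime F₊ τ)
    (hR : Measurable[hτ.measurableSpace] R) (t : ℝ≥0) :
    MeasurableSet[F₊ t] {ω | τ ω ≤ t ∧ clockWorkload J τ R t ω < 0} := by
  have hlevel : Measurable[F₊ t] ((J t) -
      {ω | τ ω ≤ t}.indicator fun ω => R ω * (t - (τ ω).untopA)) :=
    ((hJ.adapted t).mono (le_rightCont F t) le_rfl).sub
      (measurable_indicator_of_isStoppingTime hτ
        (hR.mul (hτ.measurable.untopA.coe_nnreal_real.const_sub _)) t)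
  convert (hτ t).inter (hlevel (measurableSet_Iio (a := 0))) using 1
  ext ω
  refine and_congr_right fun h => ?_
  rw [Set.mem_preimage, Pi.sub_apply, Set.indicator_of_mem (s := {ω | τ ω ≤ t}) h]
  rfl

lemma isStoppingTime_clockPassageTime (hJ : IsSubordinator P F J) (hτ : IsStoppingTime F₊ τ)
    (hR : Measurable[hτ.measurableSpace] R) : IsStoppingTime F₊ (clockPassageTime J τ R) := by
  refine isStoppingTime_of_measurableSet_lt_of_isRightContinuous fun t => ?_
  let q := TopologicalSpace.denseSeq ℝ≥0
  have hunion : {ω | clockPassageTime J τ R ω < t} =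
      ⋃ i, ⋃ _ : q i < t, {ω | τ ω ≤ q i ∧ clockWorkload J τ R (q i) ω < 0} := by
    ext ω
    simp only [Set.mem_ofPred_eq, clockPassageTime_lt_iff, Set.mem_iUnion]
    refine ⟨fun ⟨u, hτu, hut, hu⟩ => ?_, fun ⟨i, hi, hτi, hneg⟩ => ⟨q i, hτi, hi, hneg⟩⟩
    obtain ⟨i, hui, hit, hneg⟩ :=
      exists_denseSeq_neg (hJ.continuousWithinAt_clockWorkload τ R ω u) hu hut
    exact ⟨i, hit, hτu.trans (WithTop.coe_le_coe.2 hui.le), hneg⟩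
  rw [hunion]
  exact MeasurableSet.iUnion fun i => MeasurableSet.iUnion fun hi =>
    (F₊).mono hi.le _ (measurableSet_clockWorkload_neg hJ hτ hR (q i))

end ClockStopping

section KellaWhitt

variable {Ω : Type*} [mΩ : MeasurableSpace Ω] {P : Measure Ω}
  {F : Filtration ℝ≥0 mΩ} {J : ℝ≥0 → Ω → ℝ} {τ κ : Ω → WithTop ℝ≥0} {R : Ω → ℝ} {α : ℝ}

/-- The exponent `α R - η α` of the net output `R t - J t` of the on period. -/
def netExponent (P : Measure Ω) (J : ℝ≥0 → Ω → ℝ) (R : Ω → ℝ) (α : ℝ) (ω : Ω) : ℝ :=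
  α * R ω - exponent P J α

lemma lintegral_setLIntegral_swap {S T : Type*} [MeasurableSpace S] [MeasurableSpace T]
    {μ : Measure S} {ν : Measure T} [SFinite μ] [SFinite ν] {r : T → S → Prop}
    (hr : MeasurableSet {p : T × S | r p.1 p.2}) {G : T → S → ℝ≥0∞}
    (hG : Measurable fun p : T × S => G p.1 p.2) :
    ∫⁻ s, ∫⁻ t in {t | r t s}, G t s ∂ν ∂μ = ∫⁻ t, ∫⁻ s in {s | r t s}, G t s ∂μ ∂ν := by
  have hswap := lintegral_lintegral_swap (μ := μ) (ν := ν)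
    (f := fun s t => {p : T × S | r p.1 p.2}.indicator (fun p => G p.1 p.2) (t, s))
    ((hG.indicator hr).comp measurable_swap).aemeasurable
  refine Eq.trans (lintegral_congr fun s => ?_) (hswap.trans (lintegral_congr fun t => ?_))
  · exact (lintegral_indicator (measurable_prodMk_right hr) _).symm
  · exact lintegral_indicator (measurable_prodMk_left hr) _

lemma measurable_setLIntegral_section {S T : Type*} [MeasurableSpace S] [MeasurableSpace T]
    {μ : Measure S} [SFinite μ] {r : T → S → Prop}
    (hr : MeasurableSet {p : T × S | r p.1 p.2}) {G : T → S → ℝ≥0∞}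
    (hG : Measurable fun p : T × S => G p.1 p.2) :
    Measurable fun t => ∫⁻ s in {s | r t s}, G t s ∂μ := by
  have heq (t : T) : ∫⁻ s in {s | r t s}, G t s ∂μ =
      ∫⁻ s, {p : T × S | r p.1 p.2}.indicator (fun p => G p.1 p.2) (t, s) ∂μ :=
    (lintegral_indicator (measurable_prodMk_left hr) _).symm
  simpa only [heq] using (hG.indicator hr).lintegral_prod_right'

lemma measurable_netExponent (hR : Measurable R) (α : ℝ) : Measurable (netExponent P J R α) :=
  (hR.const_mul α).sub_const _

lemma IsSubordinator.measurable_uncurry_clockWorkload (hJ : IsSubordinator P F J)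
    (hτ : Measurable τ) (hR : Measurable R) :
    Measurable (Function.uncurry (clockWorkload J τ R)) :=
  (measurable_uncurry_of_rightCont hJ.measurable hJ.rightCont).sub
    ((hR.comp measurable_snd).mul ((measurable_fst.coe_nnreal_real).sub
      (hτ.comp measurable_snd).untopA.coe_nnreal_real))

lemma IsSubordinator.measurable_clockWorkload_untopA (hJ : IsSubordinator P F J)
    (hτ : Measurable τ) (hR : Measurable R) (hκ : Measurable κ) :
    Measurable fun ω => clockWorkload J τ R (κ ω).untopA ω :=
  (hJ.measurable_uncurry_clockWorkload hτ hR).comp (hκ.untopA.prodMk measurable_id)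

lemma lintegral_exp_growth {c φ : ℝ} (hc : 0 ≤ c) (hφ : 0 ≤ φ) {a u : ℝ≥0} (hau : a ≤ u) :
    ∫⁻ t in Set.Ici a, ENNReal.ofReal (φ * (c * Real.exp (φ * (t - a))))
        ∂timeMeasure.restrict (Set.Iio u) + ENNReal.ofReal c =
      ENNReal.ofReal (c * Real.exp (φ * (u - a))) := by
  have hshift : (fun s : ℝ≥0 => (Set.Iio u).indicator
      (fun t : ℝ≥0 => ENNReal.ofReal (φ * (c * Real.exp (φ * (t - a))))) (a + s)) =
      (Set.Iio (u - a)).indicator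
        fun s : ℝ≥0 => ENNReal.ofReal c * ENNReal.ofReal (φ * Real.exp (φ * s)) := by
    ext s
    simp only [Set.indicator, Set.mem_Iio, lt_tsub_iff_left, NNReal.coe_add, add_sub_cancel_left,
      ← ENNReal.ofReal_mul hc, mul_left_comm φ c]
  rw [Measure.restrict_restrict measurableSet_Ici, Set.inter_comm,
    ← Measure.restrict_restrict measurableSet_Iio, ← lintegral_indicator measurableSet_Iio,
    setLIntegral_Ici_timeMeasure, hshift, lintegral_indicator measurableSet_Iio,
    lintegral_const_mul _ (by fun_prop), setLIntegral_Iio_mul_exp hφ, ← ENNReal.ofReal_mul hc,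
    ← ENNReal.ofReal_add (mul_nonneg hc (sub_nonneg.2 (Real.one_le_exp (by positivity)))) hc,
    NNReal.coe_sub hau]
  ring_nf

variable [IsProbabilityMeasure P]

lemma lintegral_exp_clockWorkload (hJ : IsSubordinator P F J) (hα : 0 ≤ α)
    (hτ : IsStoppingTime F₊ τ) (hR : Measurable[hτ.measurableSpace] R)
    (hκ : IsStoppingTime F₊ κ) (hτκ : τ ≤ κ) (t : ℝ≥0)
    {Z : Ω → ℝ≥0∞} (hZ : Measurable[hκ.measurableSpace] Z) :
    ∫⁻ ω in {ω | κ ω ≤ t}, Z ω * ENNReal.ofReal (Real.exp (-α * clockWorkload J τ R t ω)) ∂P =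
      ∫⁻ ω in {ω | κ ω ≤ t}, Z ω * ENNReal.ofReal
        (Real.exp (-α * clockWorkload J τ R (κ ω).untopA ω) *
          Real.exp (netExponent P J R α ω * (t - (κ ω).untopA))) ∂P := by
  let discount : Ω → ℝ := fun ω => α * (R ω * (t - (τ ω).untopA)) - exponent P J α * t
  have hmono := hτ.measurableSpace_mono hκ hτκ
  have hκt := hκ.measurableSet_le' t
  have hdiscount : Measurable[hκ.measurableSpace] discount :=
    ((hR.mul (hτ.measurable.untopA.coe_nnreal_real.const_sub _)).mono hmono le_rfl
      |>.const_mul α).sub_const _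
  have key := lintegral_stoppedProcess (hJ.martingale_wald hα)
    (fun s ω => mul_nonneg (Real.exp_pos _).le (Real.exp_pos _).le) (hJ.continuousWithinAt_wald α)
    hκ t (Z := {ω | κ ω ≤ t}.indicator fun ω => Z ω * ENNReal.ofReal (Real.exp (discount ω)))
    ((hZ.mul hdiscount.exp.ennreal_ofReal).indicator hκt)
  have hm := hκ.measurableSpace_le _ hκt
  have hrestrict (f : Ω → ℝ≥0∞) :
      ∫⁻ ω, {ω | κ ω ≤ t}.indicator (fun ω => Z ω * ENNReal.ofReal (Real.exp (discount ω))) ω *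
        f ω ∂P = ∫⁻ ω in {ω | κ ω ≤ t}, Z ω * ENNReal.ofReal (Real.exp (discount ω)) * f ω ∂P := by
    rw [← lintegral_indicator hm]
    exact lintegral_congr fun ω => (Set.indicator_mul_left _ _ _).symm
  rw [hrestrict, hrestrict] at key
  refine Eq.trans (setLIntegral_congr_fun hm fun ω _ => ?_)
    (key.symm.trans (setLIntegral_congr_fun hm fun ω hω => ?_))
  · simp only [mul_assoc, ← ENNReal.ofReal_mul (Real.exp_pos _).le, wald, ← Real.exp_add,
      clockWorkload, discount]
    ring_nf
  · simp only [mul_assoc, ← ENNReal.ofReal_mul (Real.exp_pos _).le, wald, ← Real.exp_add,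
      clockWorkload, discount, netExponent, stoppedProcess, min_eq_right (Set.mem_ofPred_eq ▸ hω)]
    ring_nf

lemma setLIntegral_exp_clockWorkload (hJ : IsSubordinator P F J) (hα : 0 ≤ α)
    (hτ : IsStoppingTime F₊ τ) (hR : Measurable[hτ.measurableSpace] R)
    (hκ : IsStoppingTime F₊ κ) (hτκ : τ ≤ κ) (t : ℝ≥0) {B : Set Ω}
    (hB : MeasurableSet[hκ.measurableSpace] B)
    {Z : Ω → ℝ≥0∞} (hZ : Measurable[hκ.measurableSpace] Z) :
    ∫⁻ ω in {ω | κ ω ≤ t},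
        Z ω * ENNReal.ofReal (Real.exp (-α * clockWorkload J τ R t ω)) ∂P.restrict B =
      ∫⁻ ω in {ω | κ ω ≤ t}, Z ω * ENNReal.ofReal
        (Real.exp (-α * clockWorkload J τ R (κ ω).untopA ω) *
          Real.exp (netExponent P J R α ω * (t - (κ ω).untopA))) ∂P.restrict B := by
  have key := lintegral_exp_clockWorkload hJ hα hτ hR hκ hτκ t (hZ.indicator hB)
  have hB' := hκ.measurableSpace_le _ hB
  have hrestrict (f : Ω → ℝ≥0∞) : ∫⁻ ω in {ω | κ ω ≤ t}, B.indicator Z ω * f ω ∂P =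
      ∫⁻ ω in {ω | κ ω ≤ t}, Z ω * f ω ∂P.restrict B := by
    rw [Measure.restrict_restrict (hκ.measurableSpace_le _ (hκ.measurableSet_le' t)),
      Set.inter_comm, ← Measure.restrict_restrict hB', ← lintegral_indicator hB']
    exact lintegral_congr fun ω => (Set.indicator_mul_left _ _ _).symm
  rwa [hrestrict, hrestrict] at key

lemma lintegral_setLIntegral_exp_clockWorkload (hJ : IsSubordinator P F J) (hα : 0 ≤ α)
    (hτ : IsStoppingTime F₊ τ) (hR : Measurable[hτ.measurableSpace] R)
    (hκ : IsStoppingTime F₊ κ) (hτκ : τ ≤ κ) (u : ℝ≥0) {B : Set Ω}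
    (hB : MeasurableSet[hκ.measurableSpace] B) (hφ : ∀ ω ∈ B, 0 ≤ netExponent P J R α ω) :
    ∫⁻ t in Set.Iio u, ∫⁻ ω in {ω | κ ω ≤ t}, ENNReal.ofReal (netExponent P J R α ω *
        Real.exp (-α * clockWorkload J τ R t ω)) ∂P.restrict B ∂timeMeasure =
      ∫⁻ ω in B, ∫⁻ t in {t : ℝ≥0 | κ ω ≤ t}, ENNReal.ofReal (netExponent P J R α ω *
        (Real.exp (-α * clockWorkload J τ R (κ ω).untopA ω) *
          Real.exp (netExponent P J R α ω * (t - (κ ω).untopA))))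
        ∂timeMeasure.restrict (Set.Iio u) ∂P := by
  have hκm : Measurable κ := hκ.measurable'
  have hRm : Measurable R := hR.mono hτ.measurableSpace_le le_rfl
  have hwork : Measurable fun p : ℝ≥0 × Ω => clockWorkload J τ R p.1 p.2 :=
    hJ.measurable_uncurry_clockWorkload hτ.measurable' hRm
  have hφm : Measurable (netExponent P J R α) := measurable_netExponent hRm α
  have : Measurable fun ω => (κ ω).untopA := hκm.untopA
  rw [lintegral_setLIntegral_swap (r := fun (t : ℝ≥0) ω => κ ω ≤ t)
    (measurableSet_le (hκm.comp measurable_snd) (by fun_prop)) (by fun_prop)]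
  refine lintegral_congr fun t => ?_
  have ht : MeasurableSet {ω | κ ω ≤ t} := measurableSet_le hκm measurable_const
  have key := setLIntegral_exp_clockWorkload hJ hα hτ hR hκ hτκ t hB
    (((hR.mono (hτ.measurableSpace_mono hκ hτκ) le_rfl).const_mul α).sub_const
      (exponent P J α)).ennreal_ofReal
  have hsplit {f : Ω → ℝ} : ∫⁻ ω in {ω | κ ω ≤ t},
      ENNReal.ofReal (netExponent P J R α ω * f ω) ∂P.restrict B = ∫⁻ ω in {ω | κ ω ≤ t},
      ENNReal.ofReal (netExponent P J R α ω) * ENNReal.ofReal (f ω) ∂P.restrict B := by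
    rw [Measure.restrict_restrict ht]
    exact setLIntegral_congr_fun (ht.inter (hκ.measurableSpace_le _ hB))
      fun ω hω => ENNReal.ofReal_mul (hφ ω hω.2)
  exact hsplit.trans (key.trans hsplit.symm)

/-- The Kella–Whitt martingale identity, obtained by integrating optional sampling of Wald's
exponential martingale over the time after `κ`. -/
theorem kellaWhitt (hJ : IsSubordinator P F J) (hα : 0 ≤ α)
    (hτ : IsStoppingTime F₊ τ) (hR : Measurable[hτ.measurableSpace] R)
    (hκ : IsStoppingTime F₊ κ) (hτκ : τ ≤ κ) (u : ℝ≥0) {B : Set Ω}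
    (hB : MeasurableSet[hκ.measurableSpace] B) (hφ : ∀ ω ∈ B, 0 ≤ netExponent P J R α ω) :
    ∫⁻ t in Set.Iio u, ∫⁻ ω in {ω | κ ω ≤ t}, ENNReal.ofReal (netExponent P J R α ω *
          Real.exp (-α * clockWorkload J τ R t ω)) ∂P.restrict B ∂timeMeasure +
        ∫⁻ ω in {ω | κ ω ≤ u}, ENNReal.ofReal
          (Real.exp (-α * clockWorkload J τ R (κ ω).untopA ω)) ∂P.restrict B =
      ∫⁻ ω in {ω | κ ω ≤ u},
        ENNReal.ofReal (Real.exp (-α * clockWorkload J τ R u ω)) ∂P.restrict B := by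
  have hκm : Measurable κ := hκ.measurable'
  have hend := hJ.measurable_clockWorkload_untopA hτ.measurable'
    (hR.mono hτ.measurableSpace_le le_rfl) hκm
  have hu : MeasurableSet {ω | κ ω ≤ u} := measurableSet_le hκm measurable_const
  have hexp := setLIntegral_exp_clockWorkload hJ hα hτ hR hκ hτκ u hB (Z := 1) measurable_const
  simp only [Pi.one_apply, one_mul] at hexp
  rw [lintegral_setLIntegral_exp_clockWorkload hJ hα hτ hR hκ hτκ u hB hφ, hexp,
    ← lintegral_indicator hu, ← lintegral_indicator hu,
    ← lintegral_add_right _ ((hend.const_mul (-α)).exp.ennreal_ofReal.indicator hu)]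
  refine setLIntegral_congr_fun (hκ.measurableSpace_le _ hB) fun ω hω => ?_
  by_cases hωu : κ ω ≤ u
  · obtain ⟨a, ha⟩ := WithTop.ne_top_iff_exists.1 (ne_top_of_le_ne_top WithTop.coe_ne_top hωu)
    have hau : a ≤ u := WithTop.coe_le_coe.1 (ha ▸ hωu)
    simp only [Set.indicator_of_mem (Set.mem_ofPred_eq ▸ hωu : ω ∈ {ω | κ ω ≤ u}), ← ha,
      WithTop.untopA, WithTop.untopD_coe, WithTop.coe_le_coe]
    exact lintegral_exp_growth (Real.exp_pos _).le (hφ ω hω) hau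
  · have hempty : {t : ℝ≥0 | κ ω ≤ t} ∩ Set.Iio u = ∅ :=
      Set.eq_empty_of_forall_notMem fun t ht =>
        hωu (le_trans ht.1 (WithTop.coe_le_coe.2 (Set.mem_Iio.1 ht.2).le))
    rw [Set.indicator_of_notMem (Set.mem_ofPred_eq ▸ hωu),
      Measure.restrict_restrict (measurableSet_le measurable_const (by fun_prop)), hempty,
      Set.indicator_of_notMem (Set.mem_ofPred_eq ▸ hωu), setLIntegral_empty, add_zero]

end KellaWhitt

section PassageTransform

lemma le_of_lintegral_ne_top_of_le_add {f g : ℝ≥0 → ℝ≥0∞} {b : ℝ≥0∞} (hf : Monotone f)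
    (hg : ∫⁻ u, g u ∂timeMeasure ≠ ∞) (hfg : ∀ u, f u ≤ g u + b) (u : ℝ≥0) : f u ≤ b := by
  by_contra! hlt
  have hIci : timeMeasure (Set.Ici u) = ∞ := by
    simpa [setLIntegral_one, timeMeasure_univ] using setLIntegral_Ici_timeMeasure u fun _ => 1
  refine hg (top_unique ?_)
  calc ∞ = ∫⁻ _ in Set.Ici u, (f u - b) ∂timeMeasure := by
        rw [setLIntegral_const, hIci, ENNReal.mul_top (tsub_pos_of_lt hlt).ne']
    _ ≤ ∫⁻ t in Set.Ici u, g t ∂timeMeasure := setLIntegral_mono' measurableSet_Ici fun t ht =>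
        tsub_le_iff_right.2 ((hf ht).trans (hfg t))
    _ ≤ ∫⁻ t, g t ∂timeMeasure := setLIntegral_le_lintegral _ _

lemma tendsto_setLIntegral_of_monotone {S : Type*} [MeasurableSpace S] {μ : Measure S}
    {f : S → ℝ≥0∞} {s : ℕ → Set S} (hs : Monotone s) :
    Tendsto (fun n => ∫⁻ x in s n, f x ∂μ) atTop (𝓝 (∫⁻ x in ⋃ n, s n, f x ∂μ)) := by
  rw [setLIntegral_iUnion_of_directed f hs.directed_le]
  exact tendsto_atTop_iSup fun _ _ h => lintegral_mono_set (hs h)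

lemma iUnion_Iio_natCast : ⋃ n : ℕ, Set.Iio (n : ℝ≥0) = Set.univ :=
  Set.iUnion_eq_univ_iff.2 fun t => exists_nat_gt t

lemma iUnion_le_natCast {S : Type*} (κ : S → WithTop ℝ≥0) :
    ⋃ n : ℕ, {ω | κ ω ≤ (n : ℝ≥0)} = {ω | κ ω ≠ ⊤} := by
  ext ω
  simp only [Set.mem_iUnion, Set.mem_ofPred_eq]
  refine ⟨fun ⟨n, hn⟩ => ne_top_of_le_ne_top WithTop.coe_ne_top hn, fun h => ?_⟩
  obtain ⟨a, ha⟩ := WithTop.ne_top_iff_exists.1 h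
  obtain ⟨n, hn⟩ := exists_nat_ge a
  exact ⟨n, ha ▸ WithTop.coe_le_coe.2 hn⟩

lemma monotone_setOf_le_natCast {S : Type*} (κ : S → WithTop ℝ≥0) :
    Monotone fun n : ℕ => {ω | κ ω ≤ (n : ℝ≥0)} :=
  fun _ _ h ω (hω : κ ω ≤ _) => hω.trans (WithTop.coe_le_coe.2 (Nat.cast_le.2 h))

lemma lintegral_add_eq_of_forall_add_eq {h a g p : ℝ≥0 → ℝ≥0∞} {a' p' δ : ℝ≥0∞}
    (heq : ∀ u, ∫⁻ t in Set.Iio u, h t ∂timeMeasure + a u = g u + p u) (ha : Monotone a)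
    (ha' : Tendsto (fun n : ℕ => a n) atTop (𝓝 a')) (hp : ∀ u, p u ≤ p')
    (hp' : Tendsto (fun n : ℕ => p n) atTop (𝓝 p')) (hp'_top : p' ≠ ∞) (hg : ∀ u, g u ≤ 1)
    (hδ : δ ≠ 0) (hδ_top : δ ≠ ∞) (hgh : ∀ t, δ * g t ≤ h t) :
    ∫⁻ t, h t ∂timeMeasure + a' = p' := by
  have hh : Tendsto (fun n : ℕ => ∫⁻ t in Set.Iio (n : ℝ≥0), h t ∂timeMeasure) atTop
      (𝓝 (∫⁻ t, h t ∂timeMeasure)) := by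
    have := tendsto_setLIntegral_of_monotone (μ := timeMeasure) (f := h)
      (s := fun n : ℕ => Set.Iio (n : ℝ≥0)) fun _ _ hmn => Set.Iio_subset_Iio (Nat.cast_le.2 hmn)
    rwa [iUnion_Iio_natCast, Measure.restrict_univ] at this
  have hh_top : ∫⁻ t, h t ∂timeMeasure ≠ ∞ :=
    ne_top_of_le_ne_top (ENNReal.add_ne_top.2 ⟨ENNReal.one_ne_top, hp'_top⟩)
      (le_of_tendsto' hh fun n => le_self_add.trans ((heq n).trans_le (add_le_add (hg n) (hp n))))
  have hg_top : ∫⁻ u, g u ∂timeMeasure ≠ ∞ := by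
    refine (ENNReal.lt_top_of_mul_ne_top_right (a := δ) ?_ hδ).ne
    rw [← lintegral_const_mul' _ _ hδ_top]
    exact ne_top_of_le_ne_top hh_top (lintegral_mono hgh)
  have hmono : Monotone fun u => ∫⁻ t in Set.Iio u, h t ∂timeMeasure + a u := fun u v huv =>
    add_le_add (lintegral_mono_set (Set.Iio_subset_Iio huv)) (ha huv)
  refine le_antisymm (le_of_tendsto' (hh.add ha') fun n => ?_)
    (le_of_tendsto_of_tendsto' hp' (hh.add ha') fun n => (heq n).symm ▸ le_add_self)
  exact le_of_lintegral_ne_top_of_le_add hmono hg_top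
    (fun u => (heq u).trans_le (add_le_add_right (hp u) _)) n

variable {Ω : Type*} [mΩ : MeasurableSpace Ω] {P : Measure Ω}
  {F : Filtration ℝ≥0 mΩ} {J : ℝ≥0 → Ω → ℝ} {τ : Ω → WithTop ℝ≥0} {R : Ω → ℝ} {α : ℝ}

lemma IsSubordinator.setLIntegral_exp_clockPassageTime (hJ : IsSubordinator P F J)
    (hσ : Measurable (clockPassageTime J τ R)) (α : ℝ) (μ : Measure Ω) (u : ℝ≥0) :
    ∫⁻ ω in {ω | clockPassageTime J τ R ω ≤ u}, ENNReal.ofReal (Real.exp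
      (-α * clockWorkload J τ R (clockPassageTime J τ R ω).untopA ω)) ∂μ =
      μ {ω | clockPassageTime J τ R ω ≤ u} := by
  rw [← setLIntegral_one]
  refine setLIntegral_congr_fun (measurableSet_le hσ measurable_const) fun ω hω => ?_
  have htop : clockPassageTime J τ R ω ≠ ⊤ := fun h =>
    (WithTop.coe_lt_top u).not_ge (h.symm.trans_le hω)
  obtain ⟨b, hb⟩ := WithTop.ne_top_iff_exists.1 htop
  simp only [← hb, WithTop.untopA, WithTop.untopD_coe,
    clockWorkload_eq_zero (hJ.isWorkloadPath τ R ω) hb.symm, mul_zero, Real.exp_zero,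
    ENNReal.ofReal_one]

lemma setLIntegral_add_clockPassageTime (hσ : Measurable (clockPassageTime J τ R)) (μ : Measure Ω)
    (t : ℝ≥0) (f : Ω → ℝ≥0∞) :
    ∫⁻ ω in {ω | τ ω ≤ t}, f ω ∂μ =
      ∫⁻ ω in {ω | τ ω ≤ t ∧ t < clockPassageTime J τ R ω}, f ω ∂μ +
        ∫⁻ ω in {ω | clockPassageTime J τ R ω ≤ t}, f ω ∂μ := by
  have hset : {ω | τ ω ≤ t ∧ t < clockPassageTime J τ R ω} =
      {ω | τ ω ≤ t} \ {ω | clockPassageTime J τ R ω ≤ t} := by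
    ext ω
    exact and_congr_right fun _ => not_le.symm
  have hinter : {ω | τ ω ≤ t} ∩ {ω | clockPassageTime J τ R ω ≤ t} =
      {ω | clockPassageTime J τ R ω ≤ t} :=
    Set.inter_eq_right.2 fun ω h => (le_clockPassageTime ω).trans h
  rw [← lintegral_inter_add_sdiff f _ (measurableSet_le hσ measurable_const), hset, hinter,
    add_comm]

variable [IsProbabilityMeasure P]

lemma setLIntegral_exp_clockWorkload_ne_top (hJ : IsSubordinator P F J) (hα : 0 ≤ α) {K : ℝ≥0}
    {B S : Set Ω} (hB : MeasurableSet B) (hRK : ∀ ω ∈ B, R ω ≤ K) (u : ℝ≥0)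
    (hS : MeasurableSet S) (hτu : ∀ ω ∈ S, τ ω ≤ u) :
    ∫⁻ ω in S, ENNReal.ofReal (Real.exp (-α * clockWorkload J τ R u ω)) ∂P.restrict B ≠ ∞ := by
  have hbound : ∀ ω ∈ S ∩ B, ENNReal.ofReal (Real.exp (-α * clockWorkload J τ R u ω)) ≤
      ENNReal.ofReal (Real.exp (α * (K * u))) := fun ω hω => by
    obtain ⟨a, ha⟩ := WithTop.ne_top_iff_exists.1
      (ne_top_of_le_ne_top WithTop.coe_ne_top (hτu ω hω.1))
    have hau : a ≤ u := WithTop.coe_le_coe.1 (ha.trans_le (hτu ω hω.1))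
    have hRu : R ω * (u - a) ≤ K * u :=
      mul_le_mul (hRK ω hω.2) (sub_le_self _ a.2) (sub_nonneg.2 (NNReal.coe_le_coe.2 hau)) K.2
    rw [clockWorkload, ← ha, WithTop.untopA, WithTop.untopD_coe, neg_mul, ← mul_neg]
    gcongr
    linarith [hJ.nonneg u ω]
  rw [Measure.restrict_restrict hS]
  refine ((setLIntegral_mono' (hS.inter hB) hbound).trans_lt ?_).ne
  rw [setLIntegral_const]
  exact ENNReal.mul_lt_top ENNReal.ofReal_lt_top (measure_lt_top _ _)

lemma kellaWhitt_clockPassageTime (hJ : IsSubordinator P F J) (hα : 0 ≤ α)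
    (hτ : IsStoppingTime F₊ τ) (hR : Measurable[hτ.measurableSpace] R) (u : ℝ≥0) {K : ℝ≥0}
    {B : Set Ω} (hB : MeasurableSet[hτ.measurableSpace] B) (hRK : ∀ ω ∈ B, R ω ≤ K)
    (hφ : ∀ ω ∈ B, 0 ≤ netExponent P J R α ω) :
    ∫⁻ t in Set.Iio u, ∫⁻ ω in {ω | τ ω ≤ t ∧ t < clockPassageTime J τ R ω},
          ENNReal.ofReal (netExponent P J R α ω * Real.exp (-α * clockWorkload J τ R t ω))
          ∂P.restrict B ∂timeMeasure +
        ∫⁻ ω in {ω | τ ω ≤ u}, ENNReal.ofReal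
          (Real.exp (-α * clockWorkload J τ R (τ ω).untopA ω)) ∂P.restrict B =
      ∫⁻ ω in {ω | τ ω ≤ u ∧ u < clockPassageTime J τ R ω},
          ENNReal.ofReal (Real.exp (-α * clockWorkload J τ R u ω)) ∂P.restrict B +
        P.restrict B {ω | clockPassageTime J τ R ω ≤ u} := by
  have hσ := isStoppingTime_clockPassageTime hJ hτ hR
  have hτσ : τ ≤ clockPassageTime J τ R := le_clockPassageTime
  have hσm : Measurable (clockPassageTime J τ R) := hσ.measurable'
  have hτu := kellaWhitt hJ hα hτ hR hτ le_rfl u hB hφ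
  have hσu := kellaWhitt hJ hα hτ hR hσ hτσ u (hτ.measurableSpace_mono hσ hτσ _ hB) hφ
  have hfin : ∫⁻ t in Set.Iio u, ∫⁻ ω in {ω | clockPassageTime J τ R ω ≤ t}, ENNReal.ofReal
      (netExponent P J R α ω * Real.exp (-α * clockWorkload J τ R t ω))
      ∂P.restrict B ∂timeMeasure ≠ ∞ :=
    ne_top_of_le_ne_top (setLIntegral_exp_clockWorkload_ne_top hJ hα (hτ.measurableSpace_le _ hB)
      hRK u (measurableSet_le hσm measurable_const) fun ω h => (hτσ ω).trans h)
      (hσu ▸ le_self_add)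
  have hRm : Measurable R := hR.mono hτ.measurableSpace_le le_rfl
  have hφm : Measurable (netExponent P J R α) := measurable_netExponent hRm α
  have hwork : Measurable fun p : ℝ≥0 × Ω => clockWorkload J τ R p.1 p.2 :=
    hJ.measurable_uncurry_clockWorkload hτ.measurable' hRm
  simp only [setLIntegral_add_clockPassageTime hσm (P.restrict B) _ fun ω => ENNReal.ofReal
    (netExponent P J R α ω * Real.exp (-α * clockWorkload J τ R _ ω))] at hτu
  rw [hJ.setLIntegral_exp_clockPassageTime hσm] at hσu
  rw [setLIntegral_add_clockPassageTime hσm (P.restrict B) u fun ω => ENNReal.ofReal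
    (Real.exp (-α * clockWorkload J τ R u ω)), ← hσu, lintegral_add_right _
    (measurable_setLIntegral_section (r := fun (t : ℝ≥0) ω => clockPassageTime J τ R ω ≤ t)
      (measurableSet_le (hσm.comp measurable_snd) (by fun_prop)) (by fun_prop))] at hτu
  refine (ENNReal.add_left_inj hfin).1 ?_
  rw [add_right_comm, hτu]
  ring

lemma lintegral_clock_add_lintegral_exp (hJ : IsSubordinator P F J) (hα : 0 ≤ α)
    (hτ : IsStoppingTime F₊ τ) (hτ_top : ∀ᵐ ω ∂P, τ ω ≠ ⊤)
    (hR : Measurable[hτ.measurableSpace] R) {K : ℝ≥0} {δ : ℝ} (hδ : 0 < δ)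
    {B : Set Ω} (hB : MeasurableSet[hτ.measurableSpace] B) (hRK : ∀ ω ∈ B, R ω ≤ K)
    (hφ : ∀ ω ∈ B, δ ≤ netExponent P J R α ω) :
    ∫⁻ t, ∫⁻ ω in {ω | τ ω ≤ t ∧ t < clockPassageTime J τ R ω},
          ENNReal.ofReal (netExponent P J R α ω * Real.exp (-α * clockWorkload J τ R t ω))
          ∂P.restrict B ∂timeMeasure +
        ∫⁻ ω in B, ENNReal.ofReal (Real.exp (-α * clockWorkload J τ R (τ ω).untopA ω)) ∂P =
      P.restrict B {ω | clockPassageTime J τ R ω ≠ ⊤} := by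
  have hσ := isStoppingTime_clockPassageTime hJ hτ hR
  have hσm : Measurable (clockPassageTime J τ R) := hσ.measurable'
  have hτm : Measurable τ := hτ.measurable'
  have hset (t : ℝ≥0) : MeasurableSet {ω | τ ω ≤ t ∧ t < clockPassageTime J τ R ω} :=
    (measurableSet_le hτm measurable_const).inter (measurableSet_lt measurable_const hσm)
  have hstart := tendsto_setLIntegral_of_monotone (μ := P.restrict B) (f := fun ω =>
    ENNReal.ofReal (Real.exp (-α * clockWorkload J τ R (τ ω).untopA ω)))
    (monotone_setOf_le_natCast τ)
  rw [iUnion_le_natCast, Measure.restrict_eq_self_of_ae_mem (s := {ω | τ ω ≠ ⊤})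
    (ae_restrict_of_ae hτ_top)] at hstart
  have hend := tendsto_measure_iUnion_atTop (μ := P.restrict B)
    (monotone_setOf_le_natCast (clockPassageTime J τ R))
  rw [iUnion_le_natCast] at hend
  refine lintegral_add_eq_of_forall_add_eq (δ := ENNReal.ofReal δ)
    (fun u => kellaWhitt_clockPassageTime hJ hα hτ hR u hB hRK
      fun ω hω => hδ.le.trans (hφ ω hω)) (fun u v huv => lintegral_mono_set
      fun ω (hω : τ ω ≤ u) => hω.trans (WithTop.coe_le_coe.2 huv)) hstart
    (fun u => measure_mono fun ω hω => ne_top_of_le_ne_top WithTop.coe_ne_top hω) hend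
    (measure_ne_top _ _) (fun u => ?_) (ENNReal.ofReal_pos.2 hδ).ne' ENNReal.ofReal_ne_top
    fun t => ?_
  · refine (setLIntegral_mono' (g := 1) (hset u) fun ω hω => ENNReal.ofReal_le_one.2 ?_).trans ?_
    · exact Real.exp_le_one_iff.2
        (mul_nonpos_of_nonpos_of_nonneg (neg_nonpos.2 hα) (clockWorkload_nonneg hω.1 hω.2))
    · simpa only [Pi.one_apply, setLIntegral_one] using
        (Measure.restrict_apply_le _ _).trans prob_le_one
  · rw [← lintegral_const_mul' _ _ ENNReal.ofReal_ne_top, Measure.restrict_restrict (hset t)]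
    refine setLIntegral_mono' ((hset t).inter (hτ.measurableSpace_le _ hB)) fun ω hω => ?_
    rw [← ENNReal.ofReal_mul hδ.le]
    gcongr
    exact hφ ω hω.2

end PassageTransform

section PassageMean

variable {Ω : Type*} {J : ℝ≥0 → Ω → ℝ} {τ : Ω → WithTop ℝ≥0} {R : Ω → ℝ} {α ρ : ℝ}

/-- The cycles whose output rate lies in the compact interval `[ρ + 1 / (n + 1), n]`. -/
def outputClass (ρ : ℝ) (R : Ω → ℝ) (n : ℕ) : Set Ω := {ω | ρ + 1 / (n + 1) ≤ R ω ∧ R ω ≤ n}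

lemma measurableSet_outputClass {m : MeasurableSpace Ω} (hR : Measurable[m] R) (n : ℕ) :
    MeasurableSet[m] (outputClass ρ R n) :=
  (measurableSet_le measurable_const hR).inter (measurableSet_le hR measurable_const)

lemma monotone_outputClass : Monotone (outputClass ρ R) := fun m n hmn ω hω => by
  have h1 : (1 : ℝ) / (n + 1) ≤ 1 / (m + 1) := by gcongr
  have h2 : (m : ℝ) ≤ n := Nat.cast_le.2 hmn
  exact ⟨by linarith [hω.1], by linarith [hω.2]⟩

lemma iUnion_outputClass : ⋃ n, outputClass ρ R n = {ω | ρ < R ω} := by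
  ext ω
  simp only [outputClass, Set.mem_iUnion, Set.mem_ofPred_eq]
  refine ⟨fun ⟨n, hn, _⟩ => (lt_add_of_pos_right ρ (by positivity)).trans_le hn, fun h => ?_⟩
  obtain ⟨k, hk⟩ := exists_nat_one_div_lt (sub_pos.2 h)
  obtain ⟨l, hl⟩ := exists_nat_ge (R ω)
  have h1 : (1 : ℝ) / ((max k l : ℕ) + 1) ≤ 1 / (k + 1) := by gcongr; exact le_max_left _ _
  have h2 : (l : ℝ) ≤ (max k l : ℕ) := Nat.cast_le.2 (le_max_right _ _)
  exact ⟨max k l, by linarith, by linarith⟩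

lemma clockWorkload_untopA (ω : Ω) :
    clockWorkload J τ R (τ ω).untopA ω = stoppedValue J τ ω := by
  rw [clockWorkload, sub_self, mul_zero, sub_zero, stoppedValue]

lemma tendsto_lintegral_exp_neg_mul [MeasurableSpace Ω] {μ : Measure Ω} {V : Ω → ℝ}
    (hV : Measurable V) (hV_nonneg : ∀ᵐ ω ∂μ, 0 ≤ V ω) :
    Tendsto (fun n : ℕ => ∫⁻ ω, ENNReal.ofReal (Real.exp (-(1 / (n + 1) : ℝ) * V ω)) ∂μ) atTop
      (𝓝 (μ Set.univ)) := by
  rw [← lintegral_one]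
  refine lintegral_tendsto_of_tendsto_of_monotone (fun n => by fun_prop) ?_
    (ae_of_all _ fun ω => ?_)
  · filter_upwards [hV_nonneg] with ω hω m n hmn
    refine ENNReal.ofReal_le_ofReal (Real.exp_le_exp.2 (mul_le_mul_of_nonneg_right ?_ hω))
    exact neg_le_neg (one_div_le_one_div_of_le (by positivity) (by gcongr))
  · have hc : Continuous fun α : ℝ => ENNReal.ofReal (Real.exp (-α * V ω)) :=
      ENNReal.continuous_ofReal.comp (by fun_prop)
    simpa [Function.comp_def] using (hc.tendsto 0).comp tendsto_one_div_add_atTop_nhds_zero_nat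

variable [mΩ : MeasurableSpace Ω] {P : Measure Ω} {F : Filtration ℝ≥0 mΩ}

lemma stoppedValue_nonneg (hJ : IsSubordinator P F J) (ω : Ω) : 0 ≤ stoppedValue J τ ω :=
  hJ.nonneg _ ω

lemma measurable_stoppedValue (hJ : IsSubordinator P F J) (hτ : Measurable τ) :
    Measurable (stoppedValue J τ) :=
  (measurable_uncurry_of_rightCont hJ.measurable hJ.rightCont).comp
    (hτ.untopA.prodMk measurable_id)

variable [IsProbabilityMeasure P]

lemma le_netExponent (hJ : IsSubordinator P F J) (hJm : Integrable (J 1) P) (hα : 0 ≤ α) (ω : Ω) :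
    α * (R ω - meanRate P J) ≤ netExponent P J R α ω := by
  rw [netExponent]
  linarith [hJ.exponent_le hJm hα]

lemma lintegral_clock_add_lintegral_exp_outputClass (hJ : IsSubordinator P F J)
    (hJm : Integrable (J 1) P) (hα : 0 < α) (hτ : IsStoppingTime F₊ τ)
    (hτ_top : ∀ᵐ ω ∂P, τ ω ≠ ⊤) (hR : Measurable[hτ.measurableSpace] R) (n : ℕ)
    {B : Set Ω} (hB : MeasurableSet[hτ.measurableSpace] B)
    (hBn : B ⊆ outputClass (meanRate P J) R n) :
    ∫⁻ ω in B, ∫⁻ t in {t | τ ω ≤ t ∧ t < clockPassageTime J τ R ω},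
          ENNReal.ofReal (netExponent P J R α ω * Real.exp (-α * clockWorkload J τ R t ω))
          ∂timeMeasure ∂P +
        ∫⁻ ω in B, ENNReal.ofReal (Real.exp (-α * stoppedValue J τ ω)) ∂P =
      P.restrict B {ω | clockPassageTime J τ R ω ≠ ⊤} := by
  have hσ := isStoppingTime_clockPassageTime hJ hτ hR
  have hσm : Measurable (clockPassageTime J τ R) := hσ.measurable'
  have hτm : Measurable τ := hτ.measurable'
  have hRm : Measurable R := hR.mono hτ.measurableSpace_le le_rfl
  have hφm : Measurable (netExponent P J R α) := measurable_netExponent hRm α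
  have hwork : Measurable fun p : ℝ≥0 × Ω => clockWorkload J τ R p.1 p.2 :=
    hJ.measurable_uncurry_clockWorkload hτm hRm
  have key := lintegral_clock_add_lintegral_exp hJ hα.le hτ hτ_top hR (K := n)
    (δ := α * (1 / (n + 1))) (by positivity) hB (fun ω hω => (hBn hω).2)
    fun ω hω => le_trans (mul_le_mul_of_nonneg_left (le_sub_iff_add_le'.2 (hBn hω).1) hα.le)
      (le_netExponent hJ hJm hα.le ω)
  simp only [clockWorkload_untopA] at key
  rw [← key, lintegral_setLIntegral_swap
    (r := fun (t : ℝ≥0) ω => τ ω ≤ t ∧ t < clockPassageTime J τ R ω) ?_ (by fun_prop)]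
  exact (measurableSet_le (hτm.comp measurable_snd) (by fun_prop)).inter
    (measurableSet_lt (by fun_prop) (hσm.comp measurable_snd))

lemma ae_clockPassageTime_ne_top (hJ : IsSubordinator P F J) (hJm : Integrable (J 1) P)
    (hτ : IsStoppingTime F₊ τ) (hτ_top : ∀ᵐ ω ∂P, τ ω ≠ ⊤) (hR : Measurable[hτ.measurableSpace] R)
    (hR_gt : ∀ᵐ ω ∂P, meanRate P J < R ω) : ∀ᵐ ω ∂P, clockPassageTime J τ R ω ≠ ⊤ := by
  have hV : Measurable (stoppedValue J τ) :=
    measurable_stoppedValue hJ hτ.measurable'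
  have hσ := isStoppingTime_clockPassageTime hJ hτ hR
  have hfin : MeasurableSet {ω | clockPassageTime J τ R ω ≠ ⊤} :=
    hσ.measurable' (measurableSet_singleton ⊤).compl
  have hclass (n : ℕ) : ∀ᵐ ω ∂P.restrict (outputClass (meanRate P J) R n),
      clockPassageTime J τ R ω ≠ ⊤ := by
    let μ := P.restrict (outputClass (meanRate P J) R n)
    have hle (k : ℕ) :
        ∫⁻ ω, ENNReal.ofReal (Real.exp (-(1 / (k + 1) : ℝ) * stoppedValue J τ ω)) ∂μ ≤
        μ {ω | clockPassageTime J τ R ω ≠ ⊤} :=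
      (lintegral_clock_add_lintegral_exp_outputClass hJ hJm Nat.one_div_pos_of_nat hτ hτ_top hR n
        (measurableSet_outputClass hR n) le_rfl) ▸ le_add_self
    have huniv := le_of_tendsto' (tendsto_lintegral_exp_neg_mul hV
      (ae_of_all _ (stoppedValue_nonneg hJ))) hle
    exact (ae_iff_measure_eq hfin.nullMeasurableSet).2
      (le_antisymm (measure_mono (Set.subset_univ _)) huniv)
  have hunion := ae_restrict_iUnion_iff _ _ |>.2 hclass
  rw [iUnion_outputClass] at hunion
  rwa [Measure.restrict_eq_self_of_ae_mem (s := {ω | meanRate P J < R ω}) hR_gt] at hunion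

lemma setLIntegral_clock (hJ : IsSubordinator P F J)
    (hJm : Integrable (J 1) P) (hα : 0 < α) (hτ : IsStoppingTime F₊ τ)
    (hτ_top : ∀ᵐ ω ∂P, τ ω ≠ ⊤) (hR : Measurable[hτ.measurableSpace] R)
    (hR_gt : ∀ᵐ ω ∂P, meanRate P J < R ω)
    {B : Set Ω} (hB : MeasurableSet[hτ.measurableSpace] B) :
    ∫⁻ ω in B, ∫⁻ t in {t | τ ω ≤ t ∧ t < clockPassageTime J τ R ω},
          ENNReal.ofReal (netExponent P J R α ω * Real.exp (-α * clockWorkload J τ R t ω))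
          ∂timeMeasure ∂P =
        ∫⁻ ω in B, ENNReal.ofReal (1 - Real.exp (-α * stoppedValue J τ ω)) ∂P := by
  have hV : Measurable (stoppedValue J τ) :=
    measurable_stoppedValue hJ hτ.measurable'
  have hexp (ω : Ω) : Real.exp (-α * stoppedValue J τ ω) ≤ 1 := Real.exp_le_one_iff.2
    (mul_nonpos_of_nonpos_of_nonneg (neg_nonpos.2 hα.le) (stoppedValue_nonneg hJ ω))
  have hclass (n : ℕ) := lintegral_clock_add_lintegral_exp_outputClass hJ hJm hα hτ hτ_top hR n
    (hB.inter (measurableSet_outputClass hR n)) Set.inter_subset_right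
  have hmono : Monotone fun n => B ∩ outputClass (meanRate P J) R n := fun m n hmn =>
    Set.inter_subset_inter_right _ (monotone_outputClass hmn)
  have hlim (f : Ω → ℝ≥0∞) : Tendsto
      (fun n => ∫⁻ ω in B ∩ outputClass (meanRate P J) R n, f ω ∂P) atTop
      (𝓝 (∫⁻ ω in B, f ω ∂P)) := by
    have := tendsto_setLIntegral_of_monotone (μ := P) (f := f) hmono
    rwa [← Set.inter_iUnion, iUnion_outputClass,
      ← Measure.restrict_restrict (hτ.measurableSpace_le _ hB),
      Measure.restrict_eq_self_of_ae_mem (s := {ω | meanRate P J < R ω}) hR_gt] at this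
  refine tendsto_nhds_unique (hlim _) ((hlim _).congr fun n => ?_)
  refine (ENNReal.add_left_inj (a := ∫⁻ ω in B ∩ outputClass (meanRate P J) R n,
    ENNReal.ofReal (Real.exp (-α * stoppedValue J τ ω)) ∂P) ?_).1 ?_
  · refine ((setLIntegral_mono' ?_ fun ω _ => ENNReal.ofReal_le_one.2 (hexp ω)).trans_lt ?_).ne
    · exact hτ.measurableSpace_le _ (hB.inter (measurableSet_outputClass hR n))
    · simp only [lintegral_one, measure_lt_top]
  rw [hclass, ← lintegral_add_left (by fun_prop)]
  simp only [← ENNReal.ofReal_add (sub_nonneg.2 (hexp _)) (Real.exp_pos _).le, sub_add_cancel,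
    ENNReal.ofReal_one, lintegral_one]
  exact measure_congr (eventuallyEq_univ.2 (ae_restrict_of_ae
    (ae_clockPassageTime_ne_top hJ hJm hτ hτ_top hR hR_gt))).symm

end PassageMean

section OnPeriod

variable {Ω : Type*} {J : ℝ≥0 → Ω → ℝ} {τ : Ω → WithTop ℝ≥0} {R : Ω → ℝ} {α : ℝ}

lemma setLIntegral_onPeriod {ω : Ω} (hτ : τ ω ≠ ⊤) (g : ℝ → ℝ≥0∞) :
    ∫⁻ t in {t : ℝ≥0 | τ ω ≤ t ∧ t < clockPassageTime J τ R ω}, g (clockWorkload J τ R t ω)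
        ∂timeMeasure =
      ∫⁻ s in {s | (s : ℝ≥0∞) < passageTime (onWorkload J τ R ω)}, g (onWorkload J τ R ω s)
        ∂timeMeasure := by
  obtain ⟨a, ha⟩ := WithTop.ne_top_iff_exists.1 hτ
  let S := passageTime (onWorkload J τ R ω)
  have hS (c : ℝ≥0∞) : MeasurableSet {t : ℝ≥0 | (t : ℝ≥0∞) < c} :=
    measurableSet_lt (by fun_prop) measurable_const
  have hinter : {t : ℝ≥0 | τ ω ≤ t ∧ t < clockPassageTime J τ R ω} =
      {t : ℝ≥0 | (t : ℝ≥0∞) < a + S} ∩ Set.Ici a := by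
    ext t
    rw [Set.mem_ofPred_eq, ← ha, WithTop.coe_le_coe, clockPassageTime_eq_add ha.symm, and_comm]
    rfl
  rw [hinter, ← setLIntegral_indicator (hS _), setLIntegral_Ici_timeMeasure,
    ← lintegral_indicator (hS _)]
  refine lintegral_congr fun s => ?_
  simp only [Set.indicator, Set.mem_ofPred_eq, ENNReal.coe_add,
    ENNReal.add_lt_add_iff_left ENNReal.coe_ne_top, clockWorkload_add ha.symm, S]

variable [mΩ : MeasurableSpace Ω] {P : Measure Ω} {F : Filtration ℝ≥0 mΩ}

lemma IsSubordinator.measurable_uncurry_onWorkload (hJ : IsSubordinator P F J) (hτ : Measurable τ)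
    (hR : Measurable R) : Measurable fun p : Ω × ℝ≥0 => onWorkload J τ R p.1 p.2 :=
  ((measurable_uncurry_of_rightCont hJ.measurable hJ.rightCont).comp
    (((hτ.untopA.comp measurable_fst).add measurable_snd).prodMk measurable_fst)).sub
    ((hR.comp measurable_fst).mul measurable_snd.coe_nnreal_real)

lemma IsSubordinator.measurable_passageTime (hJ : IsSubordinator P F J) (hτ : Measurable τ)
    (hR : Measurable R) : Measurable fun ω => passageTime (onWorkload J τ R ω) :=
  LevyStorage.measurable_passageTime
    (fun _ => (hJ.measurable_uncurry_onWorkload hτ hR).comp (measurable_id.prodMk measurable_const))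
    fun ω => (hJ.isWorkloadPath τ R ω).rightCont

/-- The expected occupation measure of the workload during an on period, which is taken to end with
the first passage below the origin. -/
def onOccupation (P : Measure Ω) (J : ℝ≥0 → Ω → ℝ) (τ : Ω → WithTop ℝ≥0) (R : Ω → ℝ) : Measure ℝ :=
  ((P.prod timeMeasure).restrict
    {p | (p.2 : ℝ≥0∞) < passageTime (onWorkload J τ R p.1)}).map fun p => onWorkload J τ R p.1 p.2

lemma IsSubordinator.measurableSet_onPeriod (hJ : IsSubordinator P F J) (hτ : Measurable τ)
    (hR : Measurable R) :
    MeasurableSet {p : Ω × ℝ≥0 | (p.2 : ℝ≥0∞) < passageTime (onWorkload J τ R p.1)} :=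
  measurableSet_lt (by fun_prop) ((hJ.measurable_passageTime hτ hR).comp measurable_fst)

lemma lintegral_onOccupation (hJ : IsSubordinator P F J) (hτ : Measurable τ) (hR : Measurable R)
    {g : ℝ → ℝ≥0∞} (hg : Measurable g) :
    ∫⁻ x, g x ∂(onOccupation P J τ R) =
      ∫⁻ ω, ∫⁻ s in {s | (s : ℝ≥0∞) < passageTime (onWorkload J τ R ω)}, g (onWorkload J τ R ω s)
        ∂timeMeasure ∂P := by
  have hw := hJ.measurable_uncurry_onWorkload hτ hR
  have hset := hJ.measurableSet_onPeriod hτ hR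
  rw [onOccupation, lintegral_map hg hw, ← lintegral_indicator hset]
  refine (lintegral_prod _ ((hg.comp hw).indicator hset).aemeasurable).trans ?_
  exact lintegral_congr fun ω => lintegral_indicator (measurable_prodMk_left hset) _

lemma onOccupation_univ (hJ : IsSubordinator P F J) (hτ : Measurable τ) (hR : Measurable R) :
    onOccupation P J τ R Set.univ = ∫⁻ ω, passageTime (onWorkload J τ R ω) ∂P := by
  rw [← lintegral_one, lintegral_onOccupation hJ hτ hR measurable_const]
  simp only [lintegral_one, Measure.restrict_apply_univ, timeMeasure_lt]

lemma ae_onOccupation_nonneg (hJ : IsSubordinator P F J) (hτ : Measurable τ) (hR : Measurable R) :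
    ∀ᵐ x ∂(onOccupation P J τ R), 0 ≤ x :=
  (ae_map_iff (hJ.measurable_uncurry_onWorkload hτ hR).aemeasurable measurableSet_Ici).2
    ((ae_restrict_iff' (hJ.measurableSet_onPeriod hτ hR)).2
      (ae_of_all _ fun _ hp => nonneg_of_lt_passageTime hp))

variable [IsProbabilityMeasure P]

lemma lintegral_exp_onOccupation (hJ : IsSubordinator P F J) (hJm : Integrable (J 1) P)
    (hτ : IsStoppingTime F₊ τ) (hτ_top : ∀ᵐ ω ∂P, τ ω ≠ ⊤) (hR : Measurable[hτ.measurableSpace] R)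
    (hR_gt : ∀ᵐ ω ∂P, meanRate P J < R ω) (hα : 0 < α) :
    ∫⁻ x, ENNReal.ofReal (Real.exp (-α * x)) ∂(onOccupation P J τ R) =
      ∫⁻ ω, ENNReal.ofReal
        ((1 - Real.exp (-α * stoppedValue J τ ω)) / netExponent P J R α ω) ∂P := by
  have hσ := isStoppingTime_clockPassageTime hJ hτ hR
  have hσm : Measurable (clockPassageTime J τ R) := hσ.measurable'
  have hτm : Measurable τ := hτ.measurable'
  have hRm : Measurable R := hR.mono hτ.measurableSpace_le le_rfl
  have hφm : Measurable (netExponent P J R α) := measurable_netExponent hRm α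
  have hV : Measurable (stoppedValue J τ) := measurable_stoppedValue hJ hτm
  have hwork : Measurable fun p : ℝ≥0 × Ω => clockWorkload J τ R p.1 p.2 :=
    hJ.measurable_uncurry_clockWorkload hτm hRm
  have key := lintegral_mul_eq_of_forall_setLIntegral_eq (P := P) hτ.measurableSpace_le
    (measurable_setLIntegral_section (μ := timeMeasure)
      (r := fun ω (t : ℝ≥0) => τ ω ≤ t ∧ t < clockPassageTime J τ R ω)
      ((measurableSet_le (hτm.comp measurable_fst) (by fun_prop)).inter
        (measurableSet_lt (by fun_prop) (hσm.comp measurable_fst)))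
      (G := fun ω t => ENNReal.ofReal
        (netExponent P J R α ω * Real.exp (-α * clockWorkload J τ R t ω)))
      (by fun_prop)).aemeasurable (by fun_prop)
    (fun B hB => setLIntegral_clock hJ hJm hα hτ hτ_top hR hR_gt hB)
    (Z := fun ω => ENNReal.ofReal (netExponent P J R α ω)⁻¹)
    ((hR.const_mul α).sub_const _).inv.ennreal_ofReal
  rw [lintegral_onOccupation hJ hτm hRm (by fun_prop)]
  have hφ : ∀ᵐ ω ∂P, 0 < netExponent P J R α ω := hR_gt.mono fun ω hω =>
    (mul_pos hα (sub_pos.2 hω)).trans_le (le_netExponent hJ hJm hα.le ω)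
  refine (lintegral_congr_ae ?_).trans (key.trans (lintegral_congr_ae ?_))
  · filter_upwards [hφ, hτ_top] with ω hω hτω
    rw [← setLIntegral_onPeriod hτω fun x => ENNReal.ofReal (Real.exp (-α * x)),
      ← lintegral_const_mul _ (by fun_prop)]
    simp only [← ENNReal.ofReal_mul (inv_nonneg.2 hω.le), inv_mul_cancel_left₀ hω.ne']
  · filter_upwards [hφ] with ω hω
    rw [← ENNReal.ofReal_mul (inv_nonneg.2 hω.le), div_eq_inv_mul]

lemma transform_nonneg (hJ : IsSubordinator P F J) (hJm : Integrable (J 1) P) (hα : 0 < α) {ω : Ω}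
    (hω : meanRate P J < R ω) :
    0 ≤ (1 - Real.exp (-α * stoppedValue J τ ω)) / netExponent P J R α ω := by
  refine div_nonneg (sub_nonneg.2 (Real.exp_le_one_iff.2 ?_))
    ((mul_nonneg hα.le (sub_pos.2 hω).le).trans (le_netExponent hJ hJm hα.le ω))
  exact mul_nonpos_of_nonpos_of_nonneg (neg_nonpos.2 hα.le) (stoppedValue_nonneg hJ ω)

lemma transform_le (hJ : IsSubordinator P F J) (hJm : Integrable (J 1) P) (hα : 0 < α) {ω : Ω}
    (hω : meanRate P J < R ω) :
    (1 - Real.exp (-α * stoppedValue J τ ω)) / netExponent P J R α ω ≤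
      stoppedValue J τ ω / (R ω - meanRate P J) := by
  have : 0 < α * (R ω - meanRate P J) := mul_pos hα (sub_pos.2 hω)
  calc (1 - Real.exp (-α * stoppedValue J τ ω)) / netExponent P J R α ω
      ≤ (α * stoppedValue J τ ω) / (α * (R ω - meanRate P J)) := by
        gcongr
        · exact mul_nonneg hα.le (stoppedValue_nonneg hJ ω)
        · linarith [Real.add_one_le_exp (-α * stoppedValue J τ ω)]
        · exact le_netExponent hJ hJm hα.le ω
    _ = stoppedValue J τ ω / (R ω - meanRate P J) := mul_div_mul_left _ _ hα.ne'

lemma tendsto_transform (hJ : IsSubordinator P F J) (hJm : Integrable (J 1) P) {ω : Ω}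
    (hω : meanRate P J < R ω) :
    Tendsto (fun α => (1 - Real.exp (-α * stoppedValue J τ ω)) / netExponent P J R α ω) (𝓝[>] 0)
      (𝓝 (stoppedValue J τ ω / (R ω - meanRate P J))) := by
  refine ((tendsto_one_sub_exp_div _).div ((hJ.tendsto_exponent_div hJm).const_sub (R ω))
    (sub_pos.2 hω).ne').congr' (eventually_mem_nhdsWithin.mono fun α (hα : 0 < α) => ?_)
  simp only [Pi.div_apply, netExponent]
  field_simp

lemma lintegral_passageTime (hJ : IsSubordinator P F J) (hJm : Integrable (J 1) P)
    (hτ : IsStoppingTime F₊ τ) (hτ_top : ∀ᵐ ω ∂P, τ ω ≠ ⊤) (hR : Measurable[hτ.measurableSpace] R)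
    (hR_gt : ∀ᵐ ω ∂P, meanRate P J < R ω)
    (hVR : Integrable (fun ω => stoppedValue J τ ω / (R ω - meanRate P J)) P) :
    ∫⁻ ω, passageTime (onWorkload J τ R ω) ∂P =
      ∫⁻ ω, ENNReal.ofReal (stoppedValue J τ ω / (R ω - meanRate P J)) ∂P := by
  have hτm : Measurable τ := hτ.measurable'
  have hRm : Measurable R := hR.mono hτ.measurableSpace_le le_rfl
  have hV : Measurable (stoppedValue J τ) := measurable_stoppedValue hJ hτm
  rw [← onOccupation_univ hJ hτm hRm]
  refine tendsto_nhds_unique (tendsto_lintegral_exp_neg_mul measurable_id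
    (ae_onOccupation_nonneg hJ hτm hRm)) ?_
  have hα (n : ℕ) : (0 : ℝ) < 1 / (n + 1) := Nat.one_div_pos_of_nat
  simp only [id, lintegral_exp_onOccupation hJ hJm hτ hτ_top hR hR_gt (hα _)]
  refine tendsto_lintegral_of_dominated_convergence _ (fun n => ?_)
    (fun n => hR_gt.mono fun ω hω => ENNReal.ofReal_le_ofReal (transform_le hJ hJm (hα n) hω))
    hVR.lintegral_lt_top.ne (hR_gt.mono fun ω hω => ENNReal.tendsto_ofReal
      ((tendsto_transform hJ hJm hω).comp (tendsto_nhdsWithin_iff.2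
        ⟨tendsto_one_div_add_atTop_nhds_zero_nat, Eventually.of_forall hα⟩)))
  have := measurable_netExponent (P := P) (J := J) hRm (1 / (n + 1))
  fun_prop

end OnPeriod

section OnLength

variable {Ω : Type*} {J : ℝ≥0 → Ω → ℝ} {τ : Ω → WithTop ℝ≥0} {R : Ω → ℝ}

lemma onWorkload_zero (ω : Ω) : onWorkload J τ R ω 0 = stoppedValue J τ ω := by
  simp only [onWorkload, stoppedValue, add_zero, NNReal.coe_zero, mul_zero, sub_zero]

lemma passageTime_add_le_onLength {ε : ℝ} (hε : 0 < ε) {ω : Ω} (hV : 0 < stoppedValue J τ ω) :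
    passageTime (onWorkload J τ (fun ω => R ω + ε) ω) ≤ onLength J τ R ω := by
  refine le_iInf₂ fun s hs => iInf₂_le s ?_
  have hs0 : s ≠ 0 := by
    rintro rfl
    exact hV.ne' (onWorkload_zero ω ▸ hs)
  have heq : onWorkload J τ (fun ω => R ω + ε) ω s = onWorkload J τ R ω s - ε * s := by
    simp only [onWorkload]
    ring
  rw [heq, hs, zero_sub, neg_lt_zero]
  exact mul_pos hε (NNReal.coe_pos.2 (pos_iff_ne_zero.2 hs0))

variable [mΩ : MeasurableSpace Ω] {P : Measure Ω} [IsProbabilityMeasure P]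
  {F : Filtration ℝ≥0 mΩ}

lemma tendsto_lintegral_passageTime_add (hJ : IsSubordinator P F J) (hJm : Integrable (J 1) P)
    (hτ : IsStoppingTime F₊ τ) (hτ_top : ∀ᵐ ω ∂P, τ ω ≠ ⊤) (hR : Measurable[hτ.measurableSpace] R)
    (hR_gt : ∀ᵐ ω ∂P, meanRate P J < R ω)
    (hVR : Integrable (fun ω => stoppedValue J τ ω / (R ω - meanRate P J)) P) :
    Tendsto (fun n : ℕ => ∫⁻ ω, passageTime (onWorkload J τ (fun ω => R ω + 1 / (n + 1)) ω) ∂P)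
      atTop (𝓝 (∫⁻ ω, passageTime (onWorkload J τ R ω) ∂P)) := by
  have hRm : Measurable R := hR.mono hτ.measurableSpace_le le_rfl
  have hV : Measurable (stoppedValue J τ) := measurable_stoppedValue hJ hτ.measurable'
  have hε (n : ℕ) : (0 : ℝ) < 1 / (n + 1) := Nat.one_div_pos_of_nat
  have hle (n : ℕ) {ω : Ω} (hω : meanRate P J < R ω) :
      stoppedValue J τ ω / (R ω + 1 / (n + 1) - meanRate P J) ≤
        stoppedValue J τ ω / (R ω - meanRate P J) :=
    div_le_div_of_nonneg_left (stoppedValue_nonneg hJ ω) (sub_pos.2 hω) (by linarith [hε n])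
  have hmean (n : ℕ) := lintegral_passageTime hJ hJm hτ hτ_top (hR.add_const (1 / (n + 1) : ℝ))
    (hR_gt.mono fun ω hω => by linarith [hε n])
    (hVR.mono' (Measurable.aestronglyMeasurable (by fun_prop)) (hR_gt.mono fun ω hω => by
      rw [Real.norm_of_nonneg (div_nonneg (stoppedValue_nonneg hJ ω) (by linarith [hε n]))]
      exact hle n hω))
  simp only [hmean, lintegral_passageTime hJ hJm hτ hτ_top hR hR_gt hVR]
  refine tendsto_lintegral_of_dominated_convergence _ (fun n => by fun_prop)
    (fun n => hR_gt.mono fun ω hω => ENNReal.ofReal_le_ofReal (hle n hω))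
    hVR.lintegral_lt_top.ne (hR_gt.mono fun ω hω => ENNReal.tendsto_ofReal
      (tendsto_const_nhds.div ?_ (sub_pos.2 hω).ne'))
  simpa using (tendsto_one_div_add_atTop_nhds_zero_nat.const_add (R ω)).sub_const (meanRate P J)

lemma onLength_ae_eq (hJ : IsSubordinator P F J) (hJm : Integrable (J 1) P)
    (hτ : IsStoppingTime F₊ τ) (hτ_top : ∀ᵐ ω ∂P, τ ω ≠ ⊤)
    (hV_pos : ∀ᵐ ω ∂P, 0 < stoppedValue J τ ω) (hR : Measurable[hτ.measurableSpace] R)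
    (hR_gt : ∀ᵐ ω ∂P, meanRate P J < R ω)
    (hVR : Integrable (fun ω => stoppedValue J τ ω / (R ω - meanRate P J)) P) :
    onLength J τ R =ᵐ[P] fun ω => passageTime (onWorkload J τ R ω) := by
  have hRm : Measurable R := hR.mono hτ.measurableSpace_le le_rfl
  let X : Ω → ℝ≥0∞ := fun ω =>
    ⨆ n : ℕ, passageTime (onWorkload J τ (fun ω => R ω + 1 / (n + 1)) ω)
  have hX_le : X ≤ᵐ[P] onLength J τ R := hV_pos.mono fun ω hω =>
    iSup_le fun n => passageTime_add_le_onLength Nat.one_div_pos_of_nat hω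
  have hle : onLength J τ R ≤ fun ω => passageTime (onWorkload J τ R ω) := fun ω =>
    (hJ.isWorkloadPath τ R ω).zeroTime_le_passageTime
  have hlower : ∫⁻ ω, passageTime (onWorkload J τ R ω) ∂P ≤ ∫⁻ ω, X ω ∂P :=
    le_of_tendsto' (tendsto_lintegral_passageTime_add hJ hJm hτ hτ_top hR hR_gt hVR)
      fun n => lintegral_mono fun ω => le_iSup_iff.2 fun b hb => hb n
  have hfin : ∫⁻ ω, X ω ∂P ≠ ∞ := by
    refine ((lintegral_mono_ae (hX_le.trans (ae_of_all _ hle))).trans_lt ?_).ne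
    rw [lintegral_passageTime hJ hJm hτ hτ_top hR hR_gt hVR]
    exact hVR.lintegral_lt_top
  have hX_eq := ae_eq_of_ae_le_of_lintegral_le (hX_le.trans (ae_of_all _ hle)) hfin
    (hJ.measurable_passageTime hτ.measurable' hRm).aemeasurable hlower
  filter_upwards [hX_le, hX_eq] with ω h1 h2
  exact le_antisymm (hle ω) (h2 ▸ h1)

end OnLength

section RenewalReward

/-- The number of renewals in `(0, t]` when the `n`-th renewal epoch is `E n`: the first `n` with
`t < E (n + 1)`. -/
def renewalCount (E : ℕ → ℝ) (t : ℝ) : ℕ := sInf {n | t < E (n + 1)}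

variable {E : ℕ → ℝ} {m : ℝ}

lemma lt_epoch_renewalCount_succ (hE : Tendsto E atTop atTop) (t : ℝ) :
    t < E (renewalCount E t + 1) :=
  Nat.sInf_mem (s := {n | t < E (n + 1)})
    (((tendsto_add_atTop_iff_nat 1).2 hE).eventually_gt_atTop t).exists

lemma epoch_renewalCount_le (h0 : E 0 = 0) {t : ℝ} (ht : 0 ≤ t) : E (renewalCount E t) ≤ t := by
  cases hk : renewalCount E t with
  | zero => rwa [h0]
  | succ k =>
    refine not_lt.1 (Nat.notMem_of_lt_sInf (s := {n | t < E (n + 1)}) ?_)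
    exact k.lt_succ_self.trans_eq hk.symm

lemma tendsto_renewalCount (hE : Tendsto E atTop atTop) (hmono : Monotone E) :
    Tendsto (renewalCount E) atTop atTop := by
  refine tendsto_atTop.2 fun M => ?_
  filter_upwards [eventually_ge_atTop (E M)] with t ht
  by_contra! hlt
  exact ((hmono (Nat.succ_le_of_lt hlt)).trans ht).not_gt (lt_epoch_renewalCount_succ hE t)

lemma tendsto_atTop_of_tendsto_div (hm : 0 < m) (hEm : Tendsto (fun n : ℕ => E n / n) atTop (𝓝 m)) :
    Tendsto E atTop atTop := by
  refine (hEm.pos_mul_atTop hm tendsto_natCast_atTop_atTop).congr' ?_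
  filter_upwards [eventually_ne_atTop 0] with n hn
  exact div_mul_cancel₀ _ (Nat.cast_ne_zero.2 hn)

lemma tendsto_succ_div (hEm : Tendsto (fun n : ℕ => E n / n) atTop (𝓝 m)) :
    Tendsto (fun n : ℕ => E (n + 1) / n) atTop (𝓝 m) := by
  have hdiv := ((tendsto_add_atTop_iff_nat 1).2 hEm).div
    (tendsto_natCast_div_add_atTop (1 : ℝ)) one_ne_zero
  rw [div_one] at hdiv
  refine hdiv.congr fun n => ?_
  rw [Pi.div_apply, Nat.cast_add_one, div_div_div_cancel_right₀ n.cast_add_one_ne_zero]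

variable (h0 : E 0 = 0) (hmono : Monotone E) (hm : 0 < m)
  (hEm : Tendsto (fun n : ℕ => E n / n) atTop (𝓝 m))
include h0 hmono hm hEm

lemma tendsto_div_renewalCount : Tendsto (fun t => t / renewalCount E t) atTop (𝓝 m) := by
  have hE := tendsto_atTop_of_tendsto_div hm hEm
  have hN := tendsto_renewalCount hE hmono
  refine tendsto_of_tendsto_of_tendsto_of_le_of_le' (hEm.comp hN) ((tendsto_succ_div hEm).comp hN)
    ?_ (.of_forall fun t => ?_)
  · filter_upwards [eventually_ge_atTop 0] with t ht
    exact div_le_div_of_nonneg_right (epoch_renewalCount_le h0 ht) (Nat.cast_nonneg _)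
  · exact div_le_div_of_nonneg_right (lt_epoch_renewalCount_succ hE t).le (Nat.cast_nonneg _)

variable {g : ℝ → ℝ} {C : ℝ} (hg_le : ∀ s, |g s| ≤ C)
include hg_le

lemma tendsto_integral_current_cycle_div :
    Tendsto (fun t => (∫ s in E (renewalCount E t)..t, g s) / renewalCount E t) atTop (𝓝 0) := by
  have hE := tendsto_atTop_of_tendsto_div hm hEm
  have hN := tendsto_renewalCount hE hmono
  have hcycle : Tendsto (fun t => C * ((E (renewalCount E t + 1) - E (renewalCount E t)) /
      renewalCount E t)) atTop (𝓝 0) := by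
    simpa only [Function.comp_def, ← sub_div, sub_self, mul_zero] using
      (((tendsto_succ_div hEm).sub hEm).comp hN).const_mul C
  refine squeeze_zero_norm' ?_ hcycle
  filter_upwards [eventually_ge_atTop 0] with t ht
  have hC : 0 ≤ C := (abs_nonneg _).trans (hg_le 0)
  have hle := epoch_renewalCount_le h0 ht
  rw [norm_div, Real.norm_natCast, mul_div_assoc']
  gcongr
  refine (intervalIntegral.norm_integral_le_of_norm_le_const fun s _ => hg_le s).trans ?_
  rw [abs_of_nonneg (sub_nonneg.2 hle)]
  gcongr
  exact (lt_epoch_renewalCount_succ hE t).le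

lemma tendsto_average_of_renewal {c : ℝ}
    (hgi : ∀ n, IntervalIntegrable g volume (E n) (E (n + 1)))
    (hc : Tendsto (fun n : ℕ => (∑ k ∈ Finset.range n, ∫ s in E k..E (k + 1), g s) / n) atTop
      (𝓝 c)) :
    Tendsto (fun t : ℝ => t⁻¹ * ∫ s in (0 : ℝ)..t, g s) atTop (𝓝 (c / m)) := by
  have hE := tendsto_atTop_of_tendsto_div hm hEm
  have hN := tendsto_renewalCount hE hmono
  have hmain := ((hc.comp hN).add (tendsto_integral_current_cycle_div h0 hmono hm hEm hg_le)).div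
    (tendsto_div_renewalCount h0 hmono hm hEm) hm.ne'
  rw [add_zero] at hmain
  refine hmain.congr' ?_
  filter_upwards [eventually_ge_atTop 0, hN.eventually_ne_atTop 0] with t ht hNt
  have hpast : IntervalIntegrable g volume (E 0) (E (renewalCount E t)) :=
    IntervalIntegrable.trans_iterate fun k _ => hgi k
  have hcurrent : IntervalIntegrable g volume (E (renewalCount E t)) t := by
    refine (hgi (renewalCount E t)).mono_set ?_
    rw [Set.uIcc_of_le (epoch_renewalCount_le h0 ht), Set.uIcc_of_le (hmono (Nat.le_succ _))]
    exact Set.Icc_subset_Icc_right (lt_epoch_renewalCount_succ hE t).le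
  have hsum : ∑ k ∈ Finset.range (renewalCount E t), ∫ s in E k..E (k + 1), g s =
      ∫ s in E 0..E (renewalCount E t), g s :=
    intervalIntegral.sum_integral_adjacent_intervals fun k _ => hgi k
  simp only [Pi.div_apply, Function.comp_apply]
  rw [hsum, ← add_div, intervalIntegral.integral_add_adjacent_intervals hpast hcurrent, h0,
    div_div_div_cancel_right₀ (Nat.cast_ne_zero.2 hNt), inv_mul_eq_div]

end RenewalReward

section StrongLaw

variable {Ω : Type*} [MeasurableSpace Ω] {P : Measure Ω} [IsProbabilityMeasure P]

lemma ae_infinitePi {p : Ω → Prop} (h : ∀ᵐ x ∂P, p x) :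
    ∀ᵐ ω ∂(Measure.infinitePi fun _ : ℕ => P), ∀ k, p (ω k) :=
  ae_all_iff.2 fun k =>
    (measurePreserving_eval_infinitePi (fun _ : ℕ => P) k).quasiMeasurePreserving.ae h

lemma strong_law_infinitePi {Y : Ω → ℝ} (hY : Measurable Y) (hi : Integrable Y P) :
    ∀ᵐ ω ∂(Measure.infinitePi fun _ : ℕ => P),
      Tendsto (fun n : ℕ => (∑ k ∈ Finset.range n, Y (ω k)) / n) atTop (𝓝 (∫ x, Y x ∂P)) := by
  have hmap (k : ℕ) := measurePreserving_eval_infinitePi (fun _ : ℕ => P) k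
  have hident (k : ℕ) :
      IdentDistrib (fun ω : ℕ → Ω => Y (ω k)) Y (Measure.infinitePi fun _ => P) P := by
    refine ⟨(hY.comp (hmap k).measurable).aemeasurable, hY.aemeasurable, ?_⟩
    exact (Measure.map_map hY (hmap k).measurable).symm.trans (congrArg _ (hmap k).map_eq)
  have hindep := iIndepFun_infinitePi (P := fun _ : ℕ => P) (X := fun _ => Y) fun _ => hY
  rw [← (hident 0).integral_eq]
  exact strong_law_ae_real _ ((hident 0).integrable_iff.2 hi) (fun _ _ hij => hindep.indepFun hij)
    fun k => (hident k).trans (hident 0).symm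

end StrongLaw

section Cycles

variable {Ω : Type*} {J : ℝ≥0 → Ω → ℝ} {τ : Ω → WithTop ℝ≥0} {R : Ω → ℝ}

/-- The reward collected at rate `f` during the on period of the cycle `ω`, which is taken to end
with the first passage below the origin. -/
def onReward (J : ℝ≥0 → Ω → ℝ) (τ : Ω → WithTop ℝ≥0) (R : Ω → ℝ) (f : ℝ → ℝ) (ω : Ω) : ℝ :=
  ∫ s in {s : ℝ≥0 | (s : ℝ≥0∞) < passageTime (onWorkload J τ R ω)}, f (onWorkload J τ R ω s)
    ∂timeMeasure

variable {ω : ℕ → Ω}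

lemma onIndex_eq {t : ℝ≥0} {n : ℕ} (hle : onEpoch J τ R ω n ≤ t)
    (hlt : (t : ℝ≥0∞) < onEpoch J τ R ω (n + 1)) : onIndex J τ R ω t = n := by
  refine le_antisymm (Nat.sInf_le hlt) (le_csInf ⟨n, hlt⟩ fun j hj => ?_)
  by_contra! hjn
  have hmono : onEpoch J τ R ω (j + 1) ≤ onEpoch J τ R ω n :=
    Finset.sum_le_sum_of_subset (Finset.range_mono hjn)
  exact (lt_of_lt_of_le hj (hmono.trans hle)).false

variable (hfin : ∀ k, onLength J τ R (ω k) ≠ ∞)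
include hfin

lemma onEpoch_ne_top (n : ℕ) : onEpoch J τ R ω n ≠ ∞ :=
  ENNReal.sum_ne_top.2 fun k _ => hfin k

lemma toReal_onEpoch (n : ℕ) :
    (onEpoch J τ R ω n).toReal = ∑ k ∈ Finset.range n, (onLength J τ R (ω k)).toReal :=
  ENNReal.toReal_sum fun k _ => hfin k

lemma toReal_onEpoch_succ (n : ℕ) :
    (onEpoch J τ R ω (n + 1)).toReal =
      (onEpoch J τ R ω n).toReal + (onLength J τ R (ω n)).toReal := by
  rw [toReal_onEpoch hfin, toReal_onEpoch hfin, Finset.sum_range_succ]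

lemma monotone_toReal_onEpoch : Monotone fun n => (onEpoch J τ R ω n).toReal :=
  monotone_nat_of_le_succ fun n => by
    rw [toReal_onEpoch_succ hfin]
    exact le_add_of_nonneg_right ENNReal.toReal_nonneg

lemma onProcess_eq {n : ℕ} {s : ℝ}
    (hs : s ∈ Set.Ico (onEpoch J τ R ω n).toReal (onEpoch J τ R ω (n + 1)).toReal) :
    onProcess J τ R s.toNNReal ω =
      onWorkload J τ R (ω n) (s - (onEpoch J τ R ω n).toReal).toNNReal := by
  have hs0 : 0 ≤ s := ENNReal.toReal_nonneg.trans hs.1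
  have hindex : onIndex J τ R ω s.toNNReal = n :=
    onIndex_eq ((ENNReal.le_ofReal_iff_toReal_le (onEpoch_ne_top hfin n) hs0).2 hs.1)
      ((ENNReal.ofReal_lt_iff_lt_toReal hs0 (onEpoch_ne_top hfin _)).2 hs.2)
  rw [onProcess, hindex, NNReal.sub_def, Real.coe_toNNReal _ hs0]
  rfl

variable (f : ℝ →ᵇ ℝ)

lemma intervalIntegrable_onProcess {n : ℕ} (hw : Measurable (onWorkload J τ R (ω n))) :
    IntervalIntegrable (fun s : ℝ => f (onProcess J τ R s.toNNReal ω)) volume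
      (onEpoch J τ R ω n).toReal (onEpoch J τ R ω (n + 1)).toReal := by
  have hf := f.continuous.measurable
  rw [intervalIntegrable_iff_integrableOn_Ico_of_le (monotone_toReal_onEpoch hfin n.le_succ)]
  refine IntegrableOn.congr_fun ?_ (fun s hs => congrArg f (onProcess_eq hfin hs).symm)
    measurableSet_Ico
  exact Integrable.of_bound (C := ‖f‖) (Measurable.aestronglyMeasurable (by fun_prop))
    (.of_forall fun s => f.norm_coe_le_norm _)

lemma integral_onProcess {n : ℕ}
    (hlength : onLength J τ R (ω n) = passageTime (onWorkload J τ R (ω n))) :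
    ∫ s in (onEpoch J τ R ω n).toReal..(onEpoch J τ R ω (n + 1)).toReal,
        f (onProcess J τ R s.toNNReal ω) = onReward J τ R f (ω n) := by
  have hle := monotone_toReal_onEpoch hfin n.le_succ
  have hset : Set.Iio (onLength J τ R (ω n)).toNNReal =
      {s : ℝ≥0 | (s : ℝ≥0∞) < passageTime (onWorkload J τ R (ω n))} := by
    ext s
    rw [Set.mem_Iio, ← ENNReal.coe_lt_coe, ENNReal.coe_toNNReal (hfin n), hlength,
      Set.mem_ofPred_eq]
  calc ∫ s in (onEpoch J τ R ω n).toReal..(onEpoch J τ R ω (n + 1)).toReal,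
        f (onProcess J τ R s.toNNReal ω)
      = ∫ s in (onEpoch J τ R ω n).toReal..(onEpoch J τ R ω (n + 1)).toReal,
          f (onWorkload J τ R (ω n) (s - (onEpoch J τ R ω n).toReal).toNNReal) := by
        rw [intervalIntegral.integral_of_le hle, intervalIntegral.integral_of_le hle,
          ← restrict_Ico_eq_restrict_Ioc]
        exact setIntegral_congr_fun measurableSet_Ico fun s hs =>
          congrArg f (onProcess_eq hfin hs)
    _ = ∫ s in (0 : ℝ)..(onLength J τ R (ω n)).toReal, f (onWorkload J τ R (ω n) s.toNNReal) := by
        rw [intervalIntegral.integral_comp_sub_right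
          (fun s => f (onWorkload J τ R (ω n) s.toNNReal)), sub_self, toReal_onEpoch_succ hfin,
          add_sub_cancel_left]
    _ = onReward J τ R f (ω n) := by
        rw [onReward, ← hset]
        exact intervalIntegral_comp_toNNReal (fun s => f (onWorkload J τ R (ω n) s)) _

lemma tendsto_average_onProcess (hw : ∀ k, Measurable (onWorkload J τ R (ω k)))
    (hlength : ∀ k, onLength J τ R (ω k) = passageTime (onWorkload J τ R (ω k))) {m c : ℝ}
    (hm : 0 < m)
    (hm_lim : Tendsto (fun n : ℕ => (∑ k ∈ Finset.range n, (onLength J τ R (ω k)).toReal) / n) atTop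
      (𝓝 m))
    (hc_lim : Tendsto (fun n : ℕ => (∑ k ∈ Finset.range n, onReward J τ R f (ω k)) / n) atTop
      (𝓝 c)) :
    Tendsto (fun t : ℝ => t⁻¹ * ∫ s in (0 : ℝ)..t, f (onProcess J τ R s.toNNReal ω)) atTop
      (𝓝 (c / m)) := by
  refine tendsto_average_of_renewal (E := fun n => (onEpoch J τ R ω n).toReal) (C := ‖f‖) ?_
    (monotone_toReal_onEpoch hfin) hm ?_ (fun s => f.norm_coe_le_norm _)
    (fun n => intervalIntegrable_onProcess hfin f (hw n)) ?_
  · rw [toReal_onEpoch hfin, Finset.sum_range_zero]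
  · simpa only [toReal_onEpoch hfin] using hm_lim
  · simpa only [fun k => integral_onProcess hfin f (hlength k)] using hc_lim

end Cycles

section SteadyState

lemma IsSteadyStateLaw.unique {S : Type*} [MeasurableSpace S] {Q : Measure S} [NeZero Q]
    {Y : ℝ≥0 → S → ℝ} {π₁ π₂ : ProbabilityMeasure ℝ} (h₁ : IsSteadyStateLaw Q Y π₁)
    (h₂ : IsSteadyStateLaw Q Y π₂) : π₁ = π₂ := by
  refine Subtype.ext (ext_of_forall_integral_eq_of_IsFiniteMeasure (μ := (π₁ : Measure ℝ))
    (ν := (π₂ : Measure ℝ)) fun f => ?_)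
  obtain ⟨ω, hω₁, hω₂⟩ := ((h₁ f).and (h₂ f)).exists
  exact tendsto_nhds_unique hω₁ hω₂

variable {Ω : Type*} [mΩ : MeasurableSpace Ω] {P : Measure Ω} {F : Filtration ℝ≥0 mΩ}
  {J : ℝ≥0 → Ω → ℝ} {τ : Ω → WithTop ℝ≥0} {R : Ω → ℝ}

lemma integral_indicator_onPeriod (hJ : IsSubordinator P F J) (hτ : Measurable τ)
    (hR : Measurable R) (f : ℝ → ℝ) (ω : Ω) :
    ∫ s, {p : Ω × ℝ≥0 | (p.2 : ℝ≥0∞) < passageTime (onWorkload J τ R p.1)}.indicator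
      (fun p => f (onWorkload J τ R p.1 p.2)) (ω, s) ∂timeMeasure = onReward J τ R f ω :=
  integral_indicator (measurable_prodMk_left (hJ.measurableSet_onPeriod hτ hR))

lemma measurable_onReward (hJ : IsSubordinator P F J) (hτ : Measurable τ) (hR : Measurable R)
    (f : ℝ →ᵇ ℝ) : Measurable (onReward J τ R f) := by
  have hf : StronglyMeasurable fun p : Ω × ℝ≥0 => f (onWorkload J τ R p.1 p.2) :=
    (f.continuous.measurable.comp (hJ.measurable_uncurry_onWorkload hτ hR)).stronglyMeasurable
  simpa only [integral_indicator_onPeriod hJ hτ hR] using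
    ((hf.indicator (hJ.measurableSet_onPeriod hτ hR)).integral_prod_right'
      (ν := timeMeasure)).measurable

lemma integrable_indicator_onPeriod (hJ : IsSubordinator P F J) (hτ : Measurable τ)
    (hR : Measurable R) [IsFiniteMeasure (onOccupation P J τ R)] (f : ℝ →ᵇ ℝ) :
    Integrable ({p : Ω × ℝ≥0 | (p.2 : ℝ≥0∞) < passageTime (onWorkload J τ R p.1)}.indicator
      fun p => f (onWorkload J τ R p.1 p.2)) (P.prod timeMeasure) :=
  (integrable_indicator_iff (hJ.measurableSet_onPeriod hτ hR)).2
    ((f.integrable (onOccupation P J τ R)).comp_measurable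
      (hJ.measurable_uncurry_onWorkload hτ hR))

lemma integrable_onReward (hJ : IsSubordinator P F J) (hτ : Measurable τ) (hR : Measurable R)
    [IsFiniteMeasure (onOccupation P J τ R)] (f : ℝ →ᵇ ℝ) :
    Integrable (onReward J τ R f) P := by
  simpa only [integral_indicator_onPeriod hJ hτ hR] using
    (integrable_indicator_onPeriod hJ hτ hR f).integral_prod_left

variable [IsProbabilityMeasure P]

lemma integral_onReward (hJ : IsSubordinator P F J) (hτ : Measurable τ) (hR : Measurable R)
    [IsFiniteMeasure (onOccupation P J τ R)] (f : ℝ →ᵇ ℝ) :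
    ∫ ω, onReward J τ R f ω ∂P = ∫ x, f x ∂(onOccupation P J τ R) := by
  rw [onOccupation, integral_map (hJ.measurable_uncurry_onWorkload hτ hR).aemeasurable
    f.continuous.aestronglyMeasurable, ← integral_indicator (hJ.measurableSet_onPeriod hτ hR),
    integral_prod _ (integrable_indicator_onPeriod hJ hτ hR f)]
  simp only [integral_indicator_onPeriod hJ hτ hR]

end SteadyState

section OnLaw

variable {Ω : Type*} [mΩ : MeasurableSpace Ω] {P : Measure Ω} {F : Filtration ℝ≥0 mΩ}
  {J : ℝ≥0 → Ω → ℝ} {τ : Ω → WithTop ℝ≥0} {R : Ω → ℝ} {α : ℝ}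

lemma measurable_onTransform {η : ℝ → ℝ} {ρ : ℝ} :
    Measurable fun p : ℝ × ℝ => onTransform η ρ α p.1 p.2 := by
  unfold onTransform
  split_ifs <;> fun_prop

/-- The steady-state law of the on-period workload: the expected occupation measure of an on period,
normalized by the mean length of an on period. -/
def onLaw (P : Measure Ω) (J : ℝ≥0 → Ω → ℝ) (τ : Ω → WithTop ℝ≥0) (R : Ω → ℝ) : Measure ℝ :=
  (onOccupation P J τ R Set.univ)⁻¹ • onOccupation P J τ R

lemma onLaw_Iio_zero (hJ : IsSubordinator P F J) (hτ : Measurable τ) (hR : Measurable R) :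
    onLaw P J τ R (Set.Iio 0) = 0 := by
  have hIio : onOccupation P J τ R (Set.Iio 0) = 0 :=
    measure_mono_null (fun x (hx : x < 0) => not_le.2 hx)
      (ae_iff.1 (ae_onOccupation_nonneg hJ hτ hR))
  rw [onLaw, Measure.smul_apply, hIio, smul_zero]

lemma integral_ratio_nonneg (hJ : IsSubordinator P F J) (hR_gt : ∀ᵐ ω ∂P, meanRate P J < R ω) :
    0 ≤ ∫ ω, stoppedValue J τ ω / (R ω - meanRate P J) ∂P :=
  integral_nonneg_of_ae (hR_gt.mono fun ω hω =>
    div_nonneg (stoppedValue_nonneg hJ ω) (sub_pos.2 hω).le)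

variable [IsProbabilityMeasure P]

lemma integral_div_sub_pos {V : Ω → ℝ} {ρ : ℝ} (hV : ∀ᵐ ω ∂P, 0 < V ω) (hR : ∀ᵐ ω ∂P, ρ < R ω)
    (hVR : Integrable (fun ω => V ω / (R ω - ρ)) P) : 0 < ∫ ω, V ω / (R ω - ρ) ∂P := by
  have hpos : ∀ᵐ ω ∂P, 0 < V ω / (R ω - ρ) := by
    filter_upwards [hV, hR] with ω hVω hRω using div_pos hVω (sub_pos.2 hRω)
  have hnonneg := hpos.mono fun ω hω => hω.le
  refine (integral_nonneg_of_ae hnonneg).lt_of_ne' fun h0 => ?_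
  obtain ⟨ω, hzero, hω⟩ := (((integral_eq_zero_iff_of_nonneg_ae hnonneg hVR).1 h0).and hpos).exists
  exact hω.ne' hzero

section Transform

variable (hJ : IsSubordinator P F J) (hJm : Integrable (J 1) P) (hα : 0 ≤ α)
include hJ hJm hα

lemma onTransform_nonneg {ω : Ω} (hω : meanRate P J < R ω) :
    0 ≤ onTransform (exponent P J) (meanRate P J) α (stoppedValue J τ ω) (R ω) := by
  unfold onTransform
  split_ifs with h0
  · exact div_nonneg (stoppedValue_nonneg hJ ω) (sub_pos.2 hω).le
  · exact transform_nonneg hJ hJm (hα.lt_of_ne' h0) hω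

lemma onTransform_le {ω : Ω} (hω : meanRate P J < R ω) :
    onTransform (exponent P J) (meanRate P J) α (stoppedValue J τ ω) (R ω) ≤
      stoppedValue J τ ω / (R ω - meanRate P J) := by
  unfold onTransform
  split_ifs with h0
  · exact le_rfl
  · exact transform_le hJ hJm (hα.lt_of_ne' h0) hω

lemma integrable_onTransform (hτ : Measurable τ) (hR : Measurable R)
    (hR_gt : ∀ᵐ ω ∂P, meanRate P J < R ω)
    (hVR : Integrable (fun ω => stoppedValue J τ ω / (R ω - meanRate P J)) P) :
    Integrable (fun ω =>
      onTransform (exponent P J) (meanRate P J) α (stoppedValue J τ ω) (R ω)) P := by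
  have hVR_meas := (measurable_stoppedValue hJ hτ).prodMk hR
  refine hVR.mono' (measurable_onTransform.comp hVR_meas).aestronglyMeasurable
    (hR_gt.mono fun ω hω => ?_)
  rw [Real.norm_of_nonneg (onTransform_nonneg hJ hJm hα hω)]
  exact onTransform_le hJ hJm hα hω

end Transform

variable (hJ : IsSubordinator P F J) (hJm : Integrable (J 1) P) (hτ : IsStoppingTime F₊ τ)
  (hτ_top : ∀ᵐ ω ∂P, τ ω ≠ ⊤) (hR : Measurable[hτ.measurableSpace] R)
  (hR_gt : ∀ᵐ ω ∂P, meanRate P J < R ω)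
  (hVR : Integrable (fun ω => stoppedValue J τ ω / (R ω - meanRate P J)) P)
include hJ hJm hτ hτ_top hR hR_gt hVR

lemma lintegral_exp_onOccupation_eq_ofReal (hα : 0 ≤ α) :
    ∫⁻ x, ENNReal.ofReal (Real.exp (-α * x)) ∂(onOccupation P J τ R) =
      ENNReal.ofReal
        (∫ ω, onTransform (exponent P J) (meanRate P J) α (stoppedValue J τ ω) (R ω) ∂P) := by
  have hRm : Measurable R := hR.mono hτ.measurableSpace_le le_rfl
  rw [ofReal_integral_eq_lintegral_ofReal
    (integrable_onTransform hJ hJm hα hτ.measurable' hRm hR_gt hVR)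
    (hR_gt.mono fun ω hω => onTransform_nonneg hJ hJm hα hω)]
  rcases hα.eq_or_lt with rfl | hα
  · simp only [neg_zero, zero_mul, Real.exp_zero, ENNReal.ofReal_one, lintegral_one,
      onOccupation_univ hJ hτ.measurable' hRm, onTransform, if_true,
      lintegral_passageTime hJ hJm hτ hτ_top hR hR_gt hVR]
  · simp only [onTransform, if_neg hα.ne', lintegral_exp_onOccupation hJ hJm hτ hτ_top hR hR_gt hα,
      netExponent]

lemma onOccupation_univ_eq_ofReal :
    onOccupation P J τ R Set.univ =
      ENNReal.ofReal (∫ ω, stoppedValue J τ ω / (R ω - meanRate P J) ∂P) := by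
  simpa [onTransform] using
    lintegral_exp_onOccupation_eq_ofReal hJ hJm hτ hτ_top hR hR_gt hVR le_rfl

lemma lst_onLaw (hα : 0 ≤ α) :
    lst (onLaw P J τ R) α =
      (∫ ω, onTransform (exponent P J) (meanRate P J) α (stoppedValue J τ ω) (R ω) ∂P) /
        ∫ ω, stoppedValue J τ ω / (R ω - meanRate P J) ∂P := by
  have htransform :
      0 ≤ ∫ ω, onTransform (exponent P J) (meanRate P J) α (stoppedValue J τ ω) (R ω) ∂P :=
    integral_nonneg_of_ae (hR_gt.mono fun ω hω => onTransform_nonneg hJ hJm hα hω)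
  rw [lst, onLaw, integral_smul_measure, integral_eq_lintegral_of_nonneg_ae
    (.of_forall fun x => (Real.exp_pos _).le) (by fun_prop),
    lintegral_exp_onOccupation_eq_ofReal hJ hJm hτ hτ_top hR hR_gt hVR hα,
    onOccupation_univ_eq_ofReal hJ hJm hτ hτ_top hR hR_gt hVR, ENNReal.toReal_inv,
    ENNReal.toReal_ofReal (integral_ratio_nonneg hJ hR_gt), ENNReal.toReal_ofReal htransform,
    smul_eq_mul, inv_mul_eq_div]

lemma integral_toReal_passageTime :
    ∫ ω, (passageTime (onWorkload J τ R ω)).toReal ∂P =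
      ∫ ω, stoppedValue J τ ω / (R ω - meanRate P J) ∂P := by
  have hRm : Measurable R := hR.mono hτ.measurableSpace_le le_rfl
  have hpass := hJ.measurable_passageTime hτ.measurable' hRm
  have hfin := (lintegral_passageTime hJ hJm hτ hτ_top hR hR_gt hVR).trans_lt hVR.lintegral_lt_top
  rw [integral_toReal hpass.aemeasurable (ae_lt_top hpass hfin.ne),
    ← onOccupation_univ hJ hτ.measurable' hRm,
    onOccupation_univ_eq_ofReal hJ hJm hτ hτ_top hR hR_gt hVR,
    ENNReal.toReal_ofReal (integral_ratio_nonneg hJ hR_gt)]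

lemma isFiniteMeasure_onOccupation : IsFiniteMeasure (onOccupation P J τ R) :=
  ⟨(onOccupation_univ_eq_ofReal hJ hJm hτ hτ_top hR hR_gt hVR).trans_lt ENNReal.ofReal_lt_top⟩

lemma integral_onLaw (f : ℝ →ᵇ ℝ) :
    ∫ x, f x ∂(onLaw P J τ R) =
      (∫ ω, onReward J τ R f ω ∂P) / ∫ ω, (passageTime (onWorkload J τ R ω)).toReal ∂P := by
  have hfinite := isFiniteMeasure_onOccupation hJ hJm hτ hτ_top hR hR_gt hVR
  rw [onLaw, integral_smul_measure,
    integral_onReward hJ hτ.measurable' (hR.mono hτ.measurableSpace_le le_rfl) f,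
    onOccupation_univ_eq_ofReal hJ hJm hτ hτ_top hR hR_gt hVR,
    integral_toReal_passageTime hJ hJm hτ hτ_top hR hR_gt hVR, ENNReal.toReal_inv,
    ENNReal.toReal_ofReal (integral_ratio_nonneg hJ hR_gt), smul_eq_mul, inv_mul_eq_div]

variable (hV_pos : ∀ᵐ ω ∂P, 0 < stoppedValue J τ ω)
include hV_pos

lemma isProbabilityMeasure_onLaw : IsProbabilityMeasure (onLaw P J τ R) := by
  have hpos := integral_div_sub_pos hV_pos hR_gt hVR
  refine ⟨?_⟩
  rw [onLaw, Measure.smul_apply, smul_eq_mul,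
    onOccupation_univ_eq_ofReal hJ hJm hτ hτ_top hR hR_gt hVR]
  exact ENNReal.inv_mul_cancel (ENNReal.ofReal_pos.2 hpos).ne' ENNReal.ofReal_ne_top

lemma isOnSteadyState_onLaw {π : ProbabilityMeasure ℝ} (hπ : (π : Measure ℝ) = onLaw P J τ R) :
    IsOnSteadyState P J τ R π := by
  intro f
  have hτm : Measurable τ := hτ.measurable'
  have hRm : Measurable R := hR.mono hτ.measurableSpace_le le_rfl
  have hpass := hJ.measurable_passageTime hτm hRm
  have hlength := onLength_ae_eq hJ hJm hτ hτ_top hV_pos hR hR_gt hVR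
  have hfin := (lintegral_passageTime hJ hJm hτ hτ_top hR hR_gt hVR).trans_lt hVR.lintegral_lt_top
  have hfinite := isFiniteMeasure_onOccupation hJ hJm hτ hτ_top hR hR_gt hVR
  have hmean_pos : 0 < ∫ ω, (passageTime (onWorkload J τ R ω)).toReal ∂P := by
    rw [integral_toReal_passageTime hJ hJm hτ hτ_top hR hR_gt hVR]
    exact integral_div_sub_pos hV_pos hR_gt hVR
  filter_upwards [strong_law_infinitePi hpass.ennreal_toReal
      (integrable_toReal_of_lintegral_ne_top hpass.aemeasurable hfin.ne),
    strong_law_infinitePi (measurable_onReward hJ hτm hRm f) (integrable_onReward hJ hτm hRm f),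
    ae_infinitePi (ae_lt_top hpass hfin.ne), ae_infinitePi hlength]
    with ω hmean_lim hreward_lim hfinω hlengthω
  rw [hπ, integral_onLaw hJ hJm hτ hτ_top hR hR_gt hVR]
  refine tendsto_average_onProcess (fun k => (hlengthω k).trans_ne (hfinω k).ne) f
    (fun k => (hJ.measurable_uncurry_onWorkload hτm hRm).comp measurable_prodMk_left) hlengthω
    hmean_pos ?_ hreward_lim
  simpa only [hlengthω] using hmean_lim

end OnLaw

section Decomposition

lemma lintegral_comp_of_indepFun {Ω A B : Type*} [MeasurableSpace Ω] [MeasurableSpace A]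
    [MeasurableSpace B] {P : Measure Ω} [IsFiniteMeasure P] {X : Ω → A} {Y : Ω → B}
    (hX : Measurable X) (hY : Measurable Y) (hXY : IndepFun X Y P) {f : A → B → ℝ≥0∞}
    (hf : Measurable (Function.uncurry f)) :
    ∫⁻ ω, f (X ω) (Y ω) ∂P = ∫⁻ ω, ∫⁻ ω', f (X ω') (Y ω) ∂P ∂P := by
  calc ∫⁻ ω, f (X ω) (Y ω) ∂P
      = ∫⁻ z, Function.uncurry f z ∂(P.map fun ω => (X ω, Y ω)) :=
        (lintegral_map hf (hX.prodMk hY)).symm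
    _ = ∫⁻ y, ∫⁻ x, f x y ∂(P.map X) ∂(P.map Y) := by
        rw [(indepFun_iff_map_prod_eq_prod_map_map hX.aemeasurable hY.aemeasurable).1 hXY]
        exact lintegral_prod_symm _ hf.aemeasurable
    _ = ∫⁻ ω, ∫⁻ x, f x (Y ω) ∂(P.map X) ∂P :=
        lintegral_map (hf.comp measurable_swap).lintegral_prod_right' hY
    _ = ∫⁻ ω, ∫⁻ ω', f (X ω') (Y ω) ∂P ∂P :=
        lintegral_congr fun ω => lintegral_map (hf.comp measurable_prodMk_right) hX

lemma lintegral_pow_natCast {Ω : Type*} [MeasurableSpace Ω] {P : Measure Ω} {N : Ω → ℕ}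
    (hN : Measurable N) {Z : Ω → ℝ≥0∞} (hZ : Measurable Z) (c : ℝ≥0∞) :
    ∫⁻ ω, Z ω * c ^ N ω ∂P =
      ∑' n, (∫⁻ ω, Z ω * (N ⁻¹' {n}).indicator 1 ω ∂P) * c ^ n := by
  have hind : ∀ n, Measurable ((N ⁻¹' {n}).indicator (1 : Ω → ℝ≥0∞)) := fun n =>
    measurable_one.indicator (hN (measurableSet_singleton n))
  have hpow : ∀ ω, Z ω * c ^ N ω = ∑' n, Z ω * (N ⁻¹' {n}).indicator 1 ω * c ^ n := fun ω => by
    rw [tsum_eq_single (N ω) fun n hn => by simp [Set.indicator, hn.symm]]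
    simp [Set.indicator]
  rw [lintegral_congr hpow, lintegral_tsum fun n => by fun_prop]
  exact tsum_congr fun n => lintegral_mul_const _ (hZ.mul (hind n))

lemma measurable_sum_range :
    Measurable fun p : ℕ × (ℕ → ℝ) => ∑ i ∈ Finset.range p.1, p.2 i :=
  measurable_from_prod_countable_right fun n => by
    dsimp only
    fun_prop

lemma integral_exp_neg_mul_Icc {c : ℝ} (hc : c ≠ 0) :
    ∫ u in Set.Icc (0 : ℝ) 1, Real.exp (-c * u) = (1 - Real.exp (-c)) / c := by
  rw [integral_Icc_eq_integral_Ioc, ← intervalIntegral.integral_of_le zero_le_one,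
    intervalIntegral.integral_comp_mul_left _ (neg_ne_zero.2 hc), integral_exp, mul_zero, mul_one,
    Real.exp_zero, smul_eq_mul]
  field_simp
  ring

lemma tsum_geometric_mul_pow {x q : ℝ} (hx0 : 0 ≤ x) (hx1 : x < 1) (hq0 : 0 ≤ q) (hq1 : q ≤ 1) :
    ∑' n : ℕ, ENNReal.ofReal ((1 - x) * x ^ n) * ENNReal.ofReal q ^ n =
      ENNReal.ofReal ((1 - x) / (1 - x * q)) := by
  have hxq0 : 0 ≤ x * q := mul_nonneg hx0 hq0
  have hxq1 : x * q < 1 := (mul_le_of_le_one_right hx0 hq1).trans_lt hx1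
  have hterm : ∀ n : ℕ, ENNReal.ofReal ((1 - x) * x ^ n) * ENNReal.ofReal q ^ n =
      ENNReal.ofReal ((1 - x) * (x * q) ^ n) := fun n => by
    rw [← ENNReal.ofReal_pow hq0, ← ENNReal.ofReal_mul' (pow_nonneg hq0 n), mul_pow, mul_assoc]
  rw [tsum_congr hterm, ← ENNReal.ofReal_tsum_of_nonneg
    (fun n => mul_nonneg (sub_nonneg.2 hx1.le) (pow_nonneg hxq0 n))
    ((summable_geometric_of_lt_one hxq0 hxq1).mul_left _), tsum_mul_left,
    tsum_geometric_of_lt_one hxq0 hxq1, div_eq_mul_inv]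

variable {Ω : Type*} [MeasurableSpace Ω] {P : Measure Ω}
  {η : ℝ → ℝ} {ρ : ℝ} {V R U : Ω → ℝ} {N : Ω → ℕ} {e : ℕ → Ω → ℝ} {α : ℝ}

namespace IsDecomposition

variable (h : IsDecomposition P η ρ V R U N e)
include h

lemma norm_exp_e_le_one (hα : 0 ≤ α) (i : ℕ) : ∀ᵐ ω ∂P, ‖Real.exp (-α * e i ω)‖ ≤ 1 := by
  filter_upwards [h.e_nonneg i] with ω hω
  rw [Real.norm_of_nonneg (Real.exp_pos _).le, Real.exp_le_one_iff]
  exact mul_nonpos_of_nonpos_of_nonneg (neg_nonpos.2 hα) hω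

lemma mgf_uniform {c : ℝ} (hc : c ≠ 0) : mgf U P (-c) = (1 - Real.exp (-c)) / c := by
  rw [← integral_exp_neg_mul_Icc hc, ← h.uniform, ← mgf_id_map h.measurable_U.aemeasurable]
  rfl

lemma measurable_randomSum : Measurable fun ω => ∑ i ∈ Finset.range (N ω), e i ω :=
  measurable_sum_range.comp (h.measurable_N.prodMk (measurable_pi_lambda _ h.measurable_e))

lemma integral_exp_partialSum (hα : 0 < α) {v : ℝ} (hv : v ≠ 0) (n : ℕ) :
    ∫ ω, Real.exp (-α * (U ω * v + ∑ i ∈ Finset.range n, e i ω)) ∂P =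
      (1 - Real.exp (-α * v)) / (α * v) * (η α / (ρ * α)) ^ n := by
  have hU := h.measurable_U
  have he := h.measurable_e
  have hind : IndepFun (fun ω => v * U ω) (∑ i ∈ Finset.range n, e i) P := by
    have := h.indep_U_e.comp (measurable_const_mul v)
      (by fun_prop : Measurable fun x : ℕ → ℝ => ∑ i ∈ Finset.range n, x i)
    refine this.congr .rfl (.of_forall fun ω => ?_)
    simp only [Function.comp_apply, Finset.sum_apply]
  have hadd := hind.mgf_add (t := -α) (by fun_prop) (by fun_prop)
  have hmgf_e : ∀ i, mgf (e i) P (-α) = η α / (ρ * α) := fun i => h.e_lst i α hα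
  simp only [mgf_const_mul, h.indep_e.mgf_sum he, mul_neg, mul_comm v α,
    h.mgf_uniform (mul_ne_zero hα.ne' hv), hmgf_e, Finset.prod_const, Finset.card_range] at hadd
  rw [neg_mul, ← hadd, mgf]
  simp only [Pi.add_apply, Finset.sum_apply, mul_comm v]

variable [IsProbabilityMeasure P]

lemma ratio_pos (hα : 0 < α) : 0 < η α / (ρ * α) := by
  have hmeas := h.measurable_e 0
  rw [← h.e_lst 0 α hα]
  exact integral_exp_pos (.of_bound (by fun_prop) 1 (h.norm_exp_e_le_one hα.le 0))

lemma ratio_le_one (hα : 0 < α) : η α / (ρ * α) ≤ 1 := by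
  rw [← h.e_lst 0 α hα]
  simpa using (le_abs_self _).trans
    (norm_integral_le_of_norm_le_const (h.norm_exp_e_le_one hα.le 0))

lemma rho_ne_zero : ρ ≠ 0 := by
  rintro rfl
  simpa using h.ratio_pos one_pos

lemma lintegral_exp_partialSum (hα : 0 < α) {v : ℝ} (hv : 0 < v) (n : ℕ) :
    ∫⁻ ω, ENNReal.ofReal (Real.exp (-α * (U ω * v + ∑ i ∈ Finset.range n, e i ω))) ∂P =
      ENNReal.ofReal ((1 - Real.exp (-α * v)) / (α * v)) * ENNReal.ofReal (η α / (ρ * α)) ^ n := by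
  have hq := h.ratio_pos hα
  have hexp : Real.exp (-α * v) < 1 := Real.exp_lt_one_iff.2 (by nlinarith)
  have hvalue : 0 < (1 - Real.exp (-α * v)) / (α * v) :=
    div_pos (sub_pos.2 hexp) (mul_pos hα hv)
  have hint := h.integral_exp_partialSum hα hv.ne' n
  rw [← ofReal_integral_eq_lintegral_ofReal
    (.of_integral_ne_zero (hint.trans_ne (mul_pos hvalue (pow_pos hq n)).ne'))
    (.of_forall fun ω => (Real.exp_pos _).le), hint, ENNReal.ofReal_mul hvalue.le,
    ENNReal.ofReal_pow hq.le]

lemma lintegral_mul_exp_randomSum (hV : ∀ᵐ ω ∂P, 0 < V ω) (hα : 0 < α) {g : ℝ × ℝ → ℝ≥0∞}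
    (hg : Measurable g) :
    ∫⁻ ω, g (V ω, R ω) * ENNReal.ofReal
        (Real.exp (-α * (U ω * V ω + ∑ i ∈ Finset.range (N ω), e i ω))) ∂P =
      ∫⁻ ω, g (V ω, R ω) * ENNReal.ofReal ((1 - Real.exp (-α * V ω)) / (α * V ω)) *
        ENNReal.ofReal (η α / (ρ * α)) ^ N ω ∂P := by
  have hUe : Measurable fun ω => (U ω, fun i => e i ω) :=
    h.measurable_U.prodMk (measurable_pi_lambda _ h.measurable_e)
  have hVRN : Measurable fun ω => (V ω, R ω, N ω) :=
    h.measurable_V.prodMk (h.measurable_R.prodMk h.measurable_N)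
  have hsum : Measurable fun p : (ℝ × (ℕ → ℝ)) × (ℝ × ℝ × ℕ) =>
      ∑ i ∈ Finset.range p.2.2.2, p.1.2 i :=
    measurable_sum_range.comp (measurable_snd.snd.snd.prodMk measurable_fst.snd)
  refine (lintegral_comp_of_indepFun hUe hVRN h.indep_VRN (f := fun x y => g (y.1, y.2.1) *
    ENNReal.ofReal (Real.exp (-α * (x.1 * y.1 + ∑ i ∈ Finset.range y.2.2, x.2 i))))
    (by simp only [Function.uncurry_def]; fun_prop)).trans (lintegral_congr_ae ?_)
  have hU := h.measurable_U
  have he := h.measurable_e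
  filter_upwards [hV] with ω hω
  rw [lintegral_const_mul _ (by fun_prop), h.lintegral_exp_partialSum hα hω, mul_assoc]

lemma lintegral_mul_indicator_geometric (n : ℕ) {g : ℝ × ℝ → ℝ≥0∞} (hg : Measurable g) :
    ∫⁻ ω, g (V ω, R ω) * (N ⁻¹' {n}).indicator 1 ω ∂P =
      ∫⁻ ω, g (V ω, R ω) * ENNReal.ofReal ((1 - ρ / R ω) * (ρ / R ω) ^ n) ∂P := by
  have hVR : Measurable fun ω => (V ω, R ω) := h.measurable_V.prodMk h.measurable_R
  have hR := h.measurable_R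
  have hN : MeasurableSet (N ⁻¹' {n}) := h.measurable_N (measurableSet_singleton n)
  have hint : Integrable (fun ω => (1 - ρ / R ω) * (ρ / R ω) ^ n) P :=
    integrable_condExp.congr (h.geometric n)
  have hnonneg : ∀ᵐ ω ∂P, 0 ≤ (1 - ρ / R ω) * (ρ / R ω) ^ n := by
    filter_upwards [h.geometric n, condExp_nonneg (μ := P)
      (m := MeasurableSpace.comap (fun ω => (V ω, R ω)) inferInstance)
      (f := (N ⁻¹' {n}).indicator fun _ => (1 : ℝ))
      (.of_forall (Set.indicator_nonneg fun _ _ => zero_le_one))] with ω hω hω0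
    rwa [hω] at hω0
  refine lintegral_mul_eq_of_forall_setLIntegral_eq hVR.comap_le
    (measurable_one.indicator hN).aemeasurable (by fun_prop) (fun s hs => ?_)
    (hg.comp (comap_measurable _))
  rw [lintegral_indicator_one hN, Measure.restrict_apply hN, Set.inter_comm,
    ← ofReal_setIntegral_one, ← setIntegral_indicator hN, ← setIntegral_condExp hVR.comap_le
    ((integrable_const (1 : ℝ)).indicator hN) hs, ← ofReal_integral_eq_lintegral_ofReal
    hint.restrict (ae_restrict_of_ae hnonneg)]
  exact congrArg _ (integral_congr_ae (ae_restrict_of_ae (h.geometric n)))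

lemma lintegral_mul_pow_geometric {c : ℝ≥0∞} {g : ℝ × ℝ → ℝ≥0∞} (hg : Measurable g) :
    ∫⁻ ω, g (V ω, R ω) * c ^ N ω ∂P =
      ∫⁻ ω, g (V ω, R ω) *
        ∑' n, ENNReal.ofReal ((1 - ρ / R ω) * (ρ / R ω) ^ n) * c ^ n ∂P := by
  have hgVR : Measurable fun ω => g (V ω, R ω) :=
    hg.comp (h.measurable_V.prodMk h.measurable_R)
  have hR := h.measurable_R
  have hterm : ∀ n : ℕ, Measurable fun ω =>
      g (V ω, R ω) * ENNReal.ofReal ((1 - ρ / R ω) * (ρ / R ω) ^ n) :=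
    fun n => hgVR.mul (by fun_prop)
  simp only [← ENNReal.tsum_mul_left, ← mul_assoc]
  rw [lintegral_pow_natCast h.measurable_N hgVR,
    lintegral_tsum fun n => ((hterm n).mul_const _).aemeasurable]
  refine tsum_congr fun n => ?_
  rw [h.lintegral_mul_indicator_geometric n hg, lintegral_mul_const _ (hterm n)]

variable (hρ : 0 ≤ ρ)
include hρ

lemma exponent_lt {r : ℝ} (hr : ρ < r) (hα : 0 < α) : η α < α * r := by
  have hρ' : 0 < ρ := hρ.lt_of_ne' h.rho_ne_zero
  calc η α ≤ ρ * α := (div_le_one (mul_pos hρ' hα)).1 (h.ratio_le_one hα)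
    _ < α * r := by rw [mul_comm]; exact mul_lt_mul_of_pos_left hr hα

lemma onTransform_nonneg {v r : ℝ} (hv : 0 ≤ v) (hr : ρ < r) (hα : 0 ≤ α) :
    0 ≤ onTransform η ρ α v r := by
  unfold onTransform
  split_ifs with h0
  · exact div_nonneg hv (sub_pos.2 hr).le
  · refine div_nonneg (sub_nonneg.2 (Real.exp_le_one_iff.2 ?_))
      (sub_pos.2 (h.exponent_lt hρ hr (hα.lt_of_ne' h0))).le
    exact mul_nonpos_of_nonpos_of_nonneg (neg_nonpos.2 hα) hv

/- The factors are the size-biasing weight, the transform of `U v`, and the transform of a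
geometric number of terms. -/
lemma mul_tsum_geometric_eq_onTransform {v r : ℝ} (hv : 0 < v) (hr : ρ < r) (hα : 0 < α) :
    ENNReal.ofReal (v / (r - ρ)) * ENNReal.ofReal ((1 - Real.exp (-α * v)) / (α * v)) *
        ∑' n : ℕ, ENNReal.ofReal ((1 - ρ / r) * (ρ / r) ^ n) *
          ENNReal.ofReal (η α / (ρ * α)) ^ n =
      ENNReal.ofReal (onTransform η ρ α v r) := by
  have hρ' : ρ ≠ 0 := h.rho_ne_zero
  have hr0 : 0 < r := hρ.trans_lt hr
  have hrρ : 0 < r - ρ := sub_pos.2 hr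
  have : 0 < α * r - η α := sub_pos.2 (h.exponent_lt hρ hr hα)
  have hexp : Real.exp (-α * v) ≤ 1 := Real.exp_le_one_iff.2 (by nlinarith)
  have hgeom : (1 - ρ / r) / (1 - ρ / r * (η α / (ρ * α))) = (r - ρ) * α / (α * r - η α) := by
    have hfactor : 1 - ρ / r * (η α / (ρ * α)) = (α * r - η α) / (r * α) := by field_simp
    rw [hfactor]
    field_simp
  rw [tsum_geometric_mul_pow (div_nonneg hρ hr0.le) ((div_lt_one hr0).2 hr) (h.ratio_pos hα).le
    (h.ratio_le_one hα), ← ENNReal.ofReal_mul (by positivity), ← ENNReal.ofReal_mul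
    (mul_nonneg (by positivity) (div_nonneg (sub_nonneg.2 hexp) (by positivity))), hgeom,
    onTransform, if_neg hα.ne']
  congr 1
  field_simp

variable (hV : ∀ᵐ ω ∂P, 0 < V ω) (hR : ∀ᵐ ω ∂P, ρ < R ω)
include hV hR

lemma lintegral_weight_mul_exp (hα : 0 ≤ α) :
    ∫⁻ ω, ENNReal.ofReal (V ω / (R ω - ρ)) * ENNReal.ofReal
        (Real.exp (-α * (U ω * V ω + ∑ i ∈ Finset.range (N ω), e i ω))) ∂P =
      ∫⁻ ω, ENNReal.ofReal (onTransform η ρ α (V ω) (R ω)) ∂P := by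
  rcases hα.eq_or_lt with rfl | hα
  · simp [onTransform]
  rw [h.lintegral_mul_exp_randomSum hV hα
      (g := fun p => ENNReal.ofReal (p.1 / (p.2 - ρ))) (by fun_prop),
    h.lintegral_mul_pow_geometric (g := fun p => ENNReal.ofReal (p.1 / (p.2 - ρ)) *
      ENNReal.ofReal ((1 - Real.exp (-α * p.1)) / (α * p.1))) (by fun_prop)]
  refine lintegral_congr_ae ?_
  filter_upwards [hV, hR] with ω hVω hRω
  exact h.mul_tsum_geometric_eq_onTransform hρ hVω hRω hα

lemma integral_sizeBiased (hVR : Integrable (fun ω => V ω / (R ω - ρ)) P) (hα : 0 ≤ α) :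
    ∫ ω, Real.exp (-α * (U ω * V ω + ∑ i ∈ Finset.range (N ω), e i ω)) ∂(sizeBiased P ρ V R) =
      (∫ ω, onTransform η ρ α (V ω) (R ω) ∂P) / ∫ ω, V ω / (R ω - ρ) ∂P := by
  have hVm := h.measurable_V
  have hRm := h.measurable_R
  have hUm := h.measurable_U
  have hsum := h.measurable_randomSum
  have hweight : 0 ≤ᵐ[P] fun ω => V ω / (R ω - ρ) := by
    filter_upwards [hV, hR] with ω hVω hRω using (div_pos hVω (sub_pos.2 hRω)).le
  have htransform : 0 ≤ᵐ[P] fun ω => onTransform η ρ α (V ω) (R ω) := by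
    filter_upwards [hV, hR] with ω hVω hRω using h.onTransform_nonneg hρ hVω.le hRω hα
  have hmeas : Measurable fun ω => onTransform η ρ α (V ω) (R ω) :=
    measurable_onTransform.comp (hVm.prodMk hRm)
  rw [integral_eq_lintegral_of_nonneg_ae (.of_forall fun ω => (Real.exp_pos _).le)
    (by fun_prop : Measurable _).aestronglyMeasurable, sizeBiased, lintegral_smul_measure,
    lintegral_withDensity_eq_lintegral_mul _ (by fun_prop) (by fun_prop)]
  simp only [Pi.mul_apply]
  rw [h.lintegral_weight_mul_exp hρ hV hR hα, smul_eq_mul, ENNReal.toReal_mul, ENNReal.toReal_inv,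
    ← integral_eq_lintegral_of_nonneg_ae htransform hmeas.aestronglyMeasurable,
    ← integral_eq_lintegral_of_nonneg_ae hweight hVR.aestronglyMeasurable, inv_mul_eq_div]

end IsDecomposition

end Decomposition

section Main

lemma isStoppingTime_of_le {Ω : Type*} {mΩ : MeasurableSpace Ω} {F G : Filtration ℝ≥0 mΩ}
    {τ : Ω → WithTop ℝ≥0} (hFG : F ≤ G) (hτ : IsStoppingTime F τ) : IsStoppingTime G τ :=
  fun t => hFG t _ (hτ t)

lemma stoppingTime_measurableSpace_le {Ω : Type*} {mΩ : MeasurableSpace Ω}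
    {F G : Filtration ℝ≥0 mΩ} {τ : Ω → WithTop ℝ≥0} (hFG : F ≤ G) (hτ : IsStoppingTime F τ) :
    hτ.measurableSpace ≤ (isStoppingTime_of_le hFG hτ).measurableSpace :=
  fun s hs => ⟨iSup_mono hFG s hs.1, fun t => hFG t _ (hs.2 t)⟩

variable {Ω : Type*} [MeasurableSpace Ω] {P : Measure Ω}

lemma ae_ne_top_of_lintegral_lt_top {τ : Ω → WithTop ℝ≥0} (hτ : Measurable τ)
    (hτ_mean : ∫⁻ ω, (τ ω : ℝ≥0∞) ∂P < ∞) : ∀ᵐ ω ∂P, τ ω ≠ ⊤ :=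
  (ae_lt_top (f := fun ω => (τ ω : ℝ≥0∞)) hτ hτ_mean.ne).mono fun _ => ne_of_lt

lemma IsSubordinator.meanRate_nonneg {F : Filtration ℝ≥0 ‹_›} {J : ℝ≥0 → Ω → ℝ}
    (hJ : IsSubordinator P F J) : 0 ≤ meanRate P J :=
  integral_nonneg fun ω => hJ.nonneg 1 ω

lemma IsDecomposition.integral_sizeBiased_of_identDistrib {Ω' : Type*} [MeasurableSpace Ω']
    {P' : Measure Ω'} [IsProbabilityMeasure P'] {η : ℝ → ℝ} {ρ α : ℝ} {V R : Ω → ℝ}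
    {V' R' U : Ω' → ℝ} {N : Ω' → ℕ} {e : ℕ → Ω' → ℝ} (h : IsDecomposition P' η ρ V' R' U N e)
    (hid : IdentDistrib (fun ω => (V' ω, R' ω)) (fun ω => (V ω, R ω)) P' P) (hρ : 0 ≤ ρ)
    (hV : ∀ᵐ ω ∂P, 0 < V ω) (hR : ∀ᵐ ω ∂P, ρ < R ω)
    (hVR : Integrable (fun ω => V ω / (R ω - ρ)) P) (hα : 0 ≤ α) :
    ∫ ω, Real.exp (-α * (U ω * V' ω + ∑ i ∈ Finset.range (N ω), e i ω)) ∂(sizeBiased P' ρ V' R') =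
      (∫ ω, onTransform η ρ α (V ω) (R ω) ∂P) / ∫ ω, V ω / (R ω - ρ) ∂P := by
  have hweight : Measurable fun p : ℝ × ℝ => p.1 / (p.2 - ρ) := by fun_prop
  have hV' : ∀ᵐ ω ∂P', 0 < V' ω :=
    hid.symm.ae_snd (measurableSet_lt measurable_const measurable_fst) hV
  have hR' : ∀ᵐ ω ∂P', ρ < R' ω :=
    hid.symm.ae_snd (measurableSet_lt measurable_const measurable_snd) hR
  rw [h.integral_sizeBiased hρ hV' hR' ((hid.comp hweight).integrable_iff.2 hVR) hα]
  exact congrArg₂ _ (hid.comp measurable_onTransform).integral_eq (hid.comp hweight).integral_eq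

end Main

end

end LevyStorage

theorem theorem1_general {Ω : Type*} [mΩ : MeasurableSpace Ω] (P : Measure Ω)
    [IsProbabilityMeasure P]
    (F : Filtration ℝ≥0 mΩ) (J : ℝ≥0 → Ω → ℝ)
    (hJ : LevyStorage.IsSubordinator P F J) (hJ_mean : Integrable (J 1) P)
    (η : ℝ → ℝ) (hη : η = LevyStorage.exponent P J)
    (ρ : ℝ) (hρ : ρ = LevyStorage.meanRate P J)
    (τ : Ω → WithTop ℝ≥0) (hτ : IsStoppingTime F.rightCont τ) (hτ_top : ∀ᵐ ω ∂P, τ ω ≠ ⊤)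
    (V : Ω → ℝ) (hV : V = stoppedValue J τ) (hV_pos : ∀ᵐ ω ∂P, 0 < V ω)
    (R : Ω → ℝ) (hR : Measurable[hτ.measurableSpace] R) (hR_gt : ∀ᵐ ω ∂P, ρ < R ω)
    (hVR : Integrable (fun ω => V ω / (R ω - ρ)) P) :
    (∃! π : ProbabilityMeasure ℝ, LevyStorage.IsOnSteadyState P J τ R π) ∧
    ∀ π : ProbabilityMeasure ℝ, LevyStorage.IsOnSteadyState P J τ R π →
      (π : Measure ℝ) (Set.Iio 0) = 0 ∧
      (∀ α : ℝ, 0 ≤ α →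
        Integrable (fun ω => LevyStorage.onTransform η ρ α (V ω) (R ω)) P ∧
        LevyStorage.lst π α =
          (∫ ω, LevyStorage.onTransform η ρ α (V ω) (R ω) ∂P) / ∫ ω, V ω / (R ω - ρ) ∂P) ∧
      ∀ {Ω' : Type*} [MeasurableSpace Ω'] (P' : Measure Ω') [IsProbabilityMeasure P']
        (V' R' U : Ω' → ℝ) (N : Ω' → ℕ) (e : ℕ → Ω' → ℝ),
        IdentDistrib (fun ω => (V' ω, R' ω)) (fun ω => (V ω, R ω)) P' P →
        LevyStorage.IsDecomposition P' η ρ V' R' U N e →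
        ∀ α : ℝ, 0 ≤ α →
          LevyStorage.lst π α =
            ∫ ω, Real.exp (-α * (U ω * V' ω + ∑ i ∈ Finset.range (N ω), e i ω))
              ∂(LevyStorage.sizeBiased P' ρ V' R') := by
  subst hη hρ hV
  have hτm : Measurable τ := hτ.measurable'
  have hRm : Measurable R := hR.mono hτ.measurableSpace_le le_rfl
  let π₀ : ProbabilityMeasure ℝ := ⟨LevyStorage.onLaw P J τ R,
    LevyStorage.isProbabilityMeasure_onLaw hJ hJ_mean hτ hτ_top hR hR_gt hVR hV_pos⟩
  have hπ₀ : LevyStorage.IsOnSteadyState P J τ R π₀ :=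
    LevyStorage.isOnSteadyState_onLaw hJ hJ_mean hτ hτ_top hR hR_gt hVR hV_pos rfl
  have hlst {α : ℝ} (hα : 0 ≤ α) := LevyStorage.lst_onLaw hJ hJ_mean hτ hτ_top hR hR_gt hVR hα
  refine ⟨⟨π₀, hπ₀, fun π hπ => hπ.unique hπ₀⟩, fun π hπ => ?_⟩
  obtain rfl : π = π₀ := hπ.unique hπ₀
  refine ⟨LevyStorage.onLaw_Iio_zero hJ hτm hRm, fun α hα =>
    ⟨LevyStorage.integrable_onTransform hJ hJ_mean hα hτm hRm hR_gt hVR, hlst hα⟩, ?_⟩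
  intro Ω' _ P' _ V' R' U N e hid hdec α hα
  exact (hlst hα).trans (hdec.integral_sizeBiased_of_identDistrib hid hJ.meanRate_nonneg hV_pos
    hR_gt hVR hα).symm

theorem theorem1 {Ω : Type*} [mΩ : MeasurableSpace Ω] (P : Measure Ω) [IsProbabilityMeasure P]
    (F : Filtration ℝ≥0 mΩ) (J : ℝ≥0 → Ω → ℝ)
    (hJ : LevyStorage.IsSubordinator P F J) (hJ_mean : Integrable (J 1) P)
    (η : ℝ → ℝ) (hη : η = LevyStorage.exponent P J)
    (ρ : ℝ) (hρ : ρ = LevyStorage.meanRate P J)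
    (τ : Ω → WithTop ℝ≥0) (hτ : IsStoppingTime F τ)
    (hτ_mean : ∫⁻ ω, (τ ω : ℝ≥0∞) ∂P < ∞)
    (V : Ω → ℝ) (hV : V = stoppedValue J τ) (hV_pos : ∀ᵐ ω ∂P, 0 < V ω)
    (R : Ω → ℝ) (hR : Measurable[hτ.measurableSpace] R) (hR_gt : ∀ᵐ ω ∂P, ρ < R ω)
    (hVR : Integrable (fun ω => V ω / (R ω - ρ)) P) :
    (∃! π : ProbabilityMeasure ℝ, LevyStorage.IsOnSteadyState P J τ R π) ∧
    ∀ π : ProbabilityMeasure ℝ, LevyStorage.IsOnSteadyState P J τ R π →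
      (π : Measure ℝ) (Set.Iio 0) = 0 ∧
      (∀ α : ℝ, 0 ≤ α →
        Integrable (fun ω => LevyStorage.onTransform η ρ α (V ω) (R ω)) P ∧
        LevyStorage.lst π α =
          (∫ ω, LevyStorage.onTransform η ρ α (V ω) (R ω) ∂P) / ∫ ω, V ω / (R ω - ρ) ∂P) ∧
      ∀ {Ω' : Type*} [MeasurableSpace Ω'] (P' : Measure Ω') [IsProbabilityMeasure P']
        (V' R' U : Ω' → ℝ) (N : Ω' → ℕ) (e : ℕ → Ω' → ℝ),
        IdentDistrib (fun ω => (V' ω, R' ω)) (fun ω => (V ω, R ω)) P' P →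
        LevyStorage.IsDecomposition P' η ρ V' R' U N e →
        ∀ α : ℝ, 0 ≤ α →
          LevyStorage.lst π α =
            ∫ ω, Real.exp (-α * (U ω * V' ω + ∑ i ∈ Finset.range (N ω), e i ω))
              ∂(LevyStorage.sizeBiased P' ρ V' R') := by
  exact theorem1_general P F J hJ hJ_mean η hη ρ hρ τ
    (LevyStorage.isStoppingTime_of_le F.le_rightCont hτ)
    (LevyStorage.ae_ne_top_of_lintegral_lt_top hτ.measurable' hτ_mean) V hV hV_pos R
    (hR.mono (LevyStorage.stoppingTime_measurableSpace_le F.le_rightCont hτ) le_rfl) hR_gt hVR
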